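/- Let $m\ge 2$, $q>1$, $b_j,c_j\in\mathbb R$, $\alpha_j>0$ for $j=1,\dots,m$, let $T_1>0$ and $T_j>(q-1)T_1$ for $j=2,\dots,m$. Put $l_1:=T_1$ and $l_j:=q^{-1}(T_j-(q-1)T_1)$ for $j\ge2$. The star graph $\Gamma_m$ has the edges $[0,T_j]$, $j=1,\dots,m$; a function on $\Gamma_m$ is a tuple $y=[y_1,\dots,y_m]$ with $y_j:[0,T_j]\to\mathbb R$. Let $W_2^1(\Gamma_m)=\bigoplus_{j=1}^m W_2^1[0,T_j]$ with the norm $\|y\|^2_{W_2^1(\Gamma_m)}=\sum_{j=1}^m\int_0^{T_j}(y_j^2+(y_j')^2)\,dt$, and let $W_2^2(\widetilde\Gamma_m)=\bigoplus_{j=1}^m W_2^2[0,l_j]$. For $y$ on $\Gamma_m$ put $$\ell_1y(t)=y_1'(t)+b_1y_1(t)+c_1y_1(q^{-1}t),\qquad \ell_jy(t)=y_j'(t)+b_jy_j(t)+c_jy_j\big(q^{-1}(t-(q-1)T_1)\big),\quad j\ge2,$$ where $y_j(s):=y_1(s+T_1)$ for $(q^{-1}-1)T_1<s<0$, $j\ge2$.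 Further let $$\tilde\ell_1y(t)=\begin{cases}q\alpha_1c_1\ell_1y(qt),&0<t<q^{-1}T_1,\\ q\sum_{k=2}^m\alpha_kc_k\ell_ky(qt-T_1),&q^{-1}T_1<t<T_1,\end{cases}$$ and $\tilde\ell_jy(t)=q\alpha_jc_j\,\ell_jy(qt+(q-1)T_1)$ for $0<t<l_j$, $j\ge2$. For $y_0\in\mathbb R$ consider the conditions $$y_1(0)=y_0;\qquad y_j(0)=y_1(T_1)\ (j\ge 2);\qquad y_j(t)=0\ \text{ for } l_j\le t\le T_j\ (j\ge 2).\tag{A}$$ The boundary value problem $\mathcal B$ consists of (A), the equations $$-\alpha_j(\ell_jy)'(t)+\alpha_jb_j\ell_jy(t)+\tilde\ell_jy(t)=0\quad\text{for a.e. } t\in(0,l_j),\ j=1,\dots,m,$$ and the Kirchhoff-type condition $$\alpha_1y_1'(T_1)-\sum_{j=2}^m\alpha_jy_j'(0)+\beta y_1(T_1)+\gamma y_1(q^{-1}T_1)=0,\qquad \beta=\alpha_1b_1-\sum_{j=2}^m\alpha_jb_j,\quad \gamma=\alpha_1c_1-\sum_{j=2}^m\alpha_jc_j.$$ The variational problem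 is to minimize $\mathcal J(y)=\sum_{j=1}^m\alpha_j\int_0^{T_j}(\ell_jy(t))^2\,dt$ over all $y\in W_2^1(\Gamma_m)$ that satisfy (A). Then there is a constant $C$, independent of $y_0$, such that for every $y_0\in\mathbb R$ the boundary value problem $\mathcal B$ has a unique solution $y\in W_2^1(\Gamma_m)\cap W_2^2(\widetilde\Gamma_m)$, and $\|y\|_{W_2^1(\Gamma_m)}\le C|y_0|$. Moreover, for every $y_0$ the variational problem has a unique solution in $W_2^1(\Gamma_m)$, and this solution is the same function $y$. -/

import Mathlib

open MeasureTheory Set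

noncomputable section

namespace StarGraph

/-- Membership in the Sobolev space `W_2^1[a,b]` of an interval, elements being identified with their
continuous representatives: `f` is absolutely continuous on `[a,b]` and its (almost everywhere
defined) derivative belongs to `L_2(a,b)`. -/
def MemW1 (f : ℝ → ℝ) (a b : ℝ) : Prop :=
  AbsolutelyContinuousOnInterval f a b ∧ MemLp (deriv f) 2 (volume.restrict (Ioo a b))

/-- Membership in the Sobolev space `W_2^2[a,b]`: `f` has on all of `[a,b]` (one-sidedly at the end
points) a derivative that belongs to `W_2^1[a,b]`. -/
def MemW2 (f : ℝ → ℝ) (a b : ℝ) : Prop :=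
  ∃ g : ℝ → ℝ, MemW1 g a b ∧ ∀ t ∈ Icc a b, HasDerivWithinAt f (g t) (Icc a b) t

/-- The square of the norm of `W_2^1[a,b]`. -/
def normSqW1 (f : ℝ → ℝ) (a b : ℝ) : ℝ :=
  (∫ t in a..b, (f t) ^ 2) + ∫ t in a..b, (deriv f t) ^ 2

/-- The parameters of the control system on the star graph with `n + 1` edges. The index `0` stands
for the incoming edge and the indices `k.succ`, `k : Fin n`, for the `n` outgoing edges. -/
structure Params (n : ℕ) where
  /-- the delay is the contraction `t ↦ q⁻¹ t` of the time -/
  q : ℝ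
  /-- lengths of the edges -/
  T : Fin (n + 1) → ℝ
  /-- coefficients at the state without delay -/
  b : Fin (n + 1) → ℝ
  /-- coefficients at the delayed state -/
  c : Fin (n + 1) → ℝ
  /-- weights in the energy functional -/
  α : Fin (n + 1) → ℝ

variable {n : ℕ}

/-- A function on the graph is a tuple `y`, where only the values of `y j` on `[0, T j]` matter. This is
equality of such functions. -/
def EqOnGraph (P : Params n) (y z : Fin (n + 1) → ℝ → ℝ) : Prop :=
  ∀ j, EqOn (y j) (z j) (Icc 0 (P.T j))

/-- The lengths `l_j`: the whole length on the incoming edge, and `q⁻¹ (T_j - (q - 1) T_1)` on the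
outgoing edges. -/
def Params.l (P : Params n) : Fin (n + 1) → ℝ :=
  Fin.cons (P.T 0) fun k : Fin n => P.q⁻¹ * (P.T k.succ - (P.q - 1) * P.T 0)

/-- The space `W_2^1(Γ)`. -/
def MemW1Graph (P : Params n) (y : Fin (n + 1) → ℝ → ℝ) : Prop :=
  ∀ j, MemW1 (y j) 0 (P.T j)

/-- The space `W_2^2(Γ̃)`, where `Γ̃` has the edges `[0, l j]`. -/
def MemW2Graph (P : Params n) (y : Fin (n + 1) → ℝ → ℝ) : Prop :=
  ∀ j, MemW2 (y j) 0 (P.l j)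

/-- The norm of `W_2^1(Γ)`. -/
def normW1Graph (P : Params n) (y : Fin (n + 1) → ℝ → ℝ) : ℝ :=
  Real.sqrt (∑ j, normSqW1 (y j) 0 (P.T j))

/-- The `k`-th outgoing component, extended to negative times by the common history on the incoming
edge. -/
def withHistory (P : Params n) (y : Fin (n + 1) → ℝ → ℝ) (k : Fin n) (t : ℝ) : ℝ :=
  if t < 0 then y 0 (t + P.T 0) else y k.succ t

/-- The first-order expressions `ℓ_j y`, in which the delay propagates through the internal
vertex. -/
def ell (P : Params n) (y : Fin (n + 1) → ℝ → ℝ) : Fin (n + 1) → ℝ → ℝ :=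
  Fin.cons
    (fun t => deriv (y 0) t + P.b 0 * y 0 t + P.c 0 * y 0 (P.q⁻¹ * t))
    fun (k : Fin n) t => deriv (y k.succ) t + P.b k.succ * y k.succ t
      + P.c k.succ * withHistory P y k (P.q⁻¹ * (t - (P.q - 1) * P.T 0))

/-- The expressions `ℓ̃_j y`. -/
def ellTilde (P : Params n) (y : Fin (n + 1) → ℝ → ℝ) : Fin (n + 1) → ℝ → ℝ :=
  Fin.cons
    (fun t => if t < P.q⁻¹ * P.T 0 then P.q * P.α 0 * P.c 0 * ell P y 0 (P.q * t)
      else P.q * ∑ k : Fin n, P.α k.succ * P.c k.succ * ell P y k.succ (P.q * t - P.T 0))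
    fun (k : Fin n) t => if t < P.l k.succ then
        P.q * P.α k.succ * P.c k.succ * ell P y k.succ (P.q * t + (P.q - 1) * P.T 0)
      else 0

/-- The second-order expressions `𝓛_j y = -α_j (ℓ_j y)' + α_j b_j ℓ_j y + ℓ̃_j y`. -/
def calL (P : Params n) (y : Fin (n + 1) → ℝ → ℝ) (j : Fin (n + 1)) (t : ℝ) : ℝ :=
  -P.α j * deriv (ell P y j) t + P.α j * P.b j * ell P y j t + ellTilde P y j t

/-- The energy functional `𝓙`. -/
def energy (P : Params n) (y : Fin (n + 1) → ℝ → ℝ) : ℝ :=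
  ∑ j, P.α j * ∫ t in (0 : ℝ)..P.T j, (ell P y j t) ^ 2

/-- The initial condition, continuity at the internal vertex, and the rest condition on the final
part of every outgoing edge. -/
structure Constraints (P : Params n) (y₀ : ℝ) (y : Fin (n + 1) → ℝ → ℝ) : Prop where
  initial : y 0 0 = y₀
  continuity : ∀ k : Fin n, y k.succ 0 = y 0 (P.T 0)
  rest : ∀ k : Fin n, ∀ t ∈ Icc (P.l k.succ) (P.T k.succ), y k.succ t = 0

def Params.β (P : Params n) : ℝ := P.α 0 * P.b 0 - ∑ k : Fin n, P.α k.succ * P.b k.succ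

def Params.γ (P : Params n) : ℝ := P.α 0 * P.c 0 - ∑ k : Fin n, P.α k.succ * P.c k.succ

/-- The Kirchhoff-type condition at the internal vertex; the derivatives there are one-sided. -/
def Kirchhoff (P : Params n) (y : Fin (n + 1) → ℝ → ℝ) : Prop :=
  P.α 0 * derivWithin (y 0) (Icc 0 (P.T 0)) (P.T 0)
    - ∑ k : Fin n, P.α k.succ * derivWithin (y k.succ) (Icc 0 (P.l k.succ)) 0
    + P.β * y 0 (P.T 0) + P.γ * y 0 (P.q⁻¹ * P.T 0) = 0

/-- `y ∈ W_2^1(Γ) ∩ W_2^2(Γ̃)` is a solution of the boundary value problem `𝓑`. -/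
structure SolvesBVP (P : Params n) (y₀ : ℝ) (y : Fin (n + 1) → ℝ → ℝ) : Prop where
  memW1 : MemW1Graph P y
  memW2 : MemW2Graph P y
  constraints : Constraints P y₀ y
  equation : ∀ j, ∀ᵐ t ∂(volume.restrict (Ioo 0 (P.l j))), calL P y j t = 0
  kirchhoff : Kirchhoff P y

/-- `y ∈ W_2^1(Γ)` is a solution of the variational problem: it satisfies the constraints and minimizes
the energy among all functions of `W_2^1(Γ)` that satisfy them. -/
structure SolvesVariational (P : Params n) (y₀ : ℝ) (y : Fin (n + 1) → ℝ → ℝ) : Prop where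
  memW1 : MemW1Graph P y
  constraints : Constraints P y₀ y
  minimal : ∀ z, MemW1Graph P z → Constraints P y₀ z → energy P y ≤ energy P z

end StarGraph

end

/-!
Why the theorem holds.

The energy is the square of the norm of `ellMap y`, the tuple of the functions `√α_j ℓ_j y` in the
Hilbert space `⨁ L_2(0, T_j)`. Hence the variational problem asks for the point of an affine
subspace that is closest to the origin, and a state with the right constraints solves it if and only
if `ellMap y` is orthogonal to `ellMap v` for all admissible variations `v`, the states that vanish
at the origin and satisfy the rest condition (`IsStationary`). Two facts make this work.

* Coercivity (`exists_sup_bound`, `exists_norm_derivMap_le`): a state that vanishes at the origin is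
  controlled by its `ell`. The equation `ell y = f` is a first order equation whose delay only
  refers to the past when time is measured along the whole path from the origin, so the weighted sup
  norm with weight `exp (-2 κ t)`, `t` being that total time, absorbs the lower order terms. With
  the converse bound, the energy norm is equivalent to the norm of the derivatives. The derivatives
  of the variations form a closed subspace, so `ellMap` maps the variations onto a closed subspace
  (`isClosed_map_ellMap`) and the orthogonal projection exists. Coercivity also shows
  that a stationary state is unique.
* The substitutions that undo the delay turn the delayed terms of the first variation into
  `ellTilde` (`sum_integral_mul_delayed`), which yields the weak form `inner_ellMap_eq_weak`. If
  `α_j ℓ_j y` has an absolutely continuous representative with the derivative prescribed by the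
  equations, integration by parts reduces the weak form to the balance of these fluxes at the
  internal vertex (`IsFlux.inner_ellMap`), which is the Kirchhoff-type condition (`kirchhoff_iff`).
  Conversely a du Bois-Reymond argument on every edge (`exists_memW1_of_forall_integral`) produces
  these representatives for a stationary state, and then `y_j'` equals a function of
  `W_2^1[0, l_j]`. So the solutions of the boundary value problem are exactly the stationary states.

Since the problem is linear, the solution for `y₀` is `y₀` times the solution for `1`, whose norm
serves as the constant `C`.
-/

noncomputable section

namespace StarGraph

variable {n : ℕ}

/-! ### Sobolev functions on an interval -/

theorem intervalIntegrable_of_memLp {φ : ℝ → ℝ} {a b : ℝ} (hab : a ≤ b)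
    (h : MemLp φ 2 (volume.restrict (Ioo a b))) : IntervalIntegrable φ volume a b := by
  rw [intervalIntegrable_iff_integrableOn_Ioo_of_le hab]
  exact h.integrable one_le_two

theorem absolutelyContinuousOnInterval_congr {f g : ℝ → ℝ} {a b : ℝ}
    (hf : AbsolutelyContinuousOnInterval f a b) (h : EqOn f g (uIcc a b)) :
    AbsolutelyContinuousOnInterval g a b := by
  rw [absolutelyContinuousOnInterval_iff] at hf ⊢
  intro ε hε
  obtain ⟨δ, hδ, H⟩ := hf ε hε
  refine ⟨δ, hδ, fun E hE hs => ?_⟩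
  convert H E hE hs using 2 with i hi
  rw [h (hE.1 i hi).1, h (hE.1 i hi).2]

theorem deriv_eqOn_of_eqOn {f g : ℝ → ℝ} {a b : ℝ} (h : EqOn f g (Ioo a b)) :
    EqOn (deriv f) (deriv g) (Ioo a b) := fun _ ht =>
  (Filter.eventuallyEq_of_mem (isOpen_Ioo.mem_nhds ht) h).deriv_eq

theorem ae_Ioo_of_forall {a b : ℝ} {p : ℝ → Prop} (h : ∀ t ∈ Ioo a b, p t) :
    ∀ᵐ t ∂(volume.restrict (Ioo a b)), p t :=
  (ae_restrict_iff' measurableSet_Ioo).2 (Filter.Eventually.of_forall h)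

theorem MemW1.congr {f g : ℝ → ℝ} {a b : ℝ} (hab : a ≤ b) (hf : MemW1 f a b)
    (h : EqOn f g (Icc a b)) : MemW1 g a b := by
  refine ⟨absolutelyContinuousOnInterval_congr hf.1 (by rwa [uIcc_of_le hab]), hf.2.ae_eq ?_⟩
  exact ae_Ioo_of_forall (deriv_eqOn_of_eqOn (h.mono Ioo_subset_Icc_self))

theorem MemW1.continuousOn {f : ℝ → ℝ} {a b : ℝ} (hab : a ≤ b) (hf : MemW1 f a b) :
    ContinuousOn f (Icc a b) := by
  have := hf.1.continuousOn
  rwa [uIcc_of_le hab] at this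

theorem MemW1.ae_differentiableAt {f : ℝ → ℝ} {a b : ℝ} (hab : a ≤ b) (hf : MemW1 f a b) :
    ∀ᵐ t ∂(volume.restrict (Ioo a b)), DifferentiableAt ℝ f t := by
  rw [ae_restrict_iff' measurableSet_Ioo]
  filter_upwards [hf.1.ae_differentiableAt] with t ht h
  exact ht (by rw [uIcc_of_le hab]; exact Ioo_subset_Icc_self h)

theorem memLp_Ioo_of_continuousOn {f : ℝ → ℝ} {a b : ℝ} (hf : ContinuousOn f (Icc a b)) :
    MemLp f 2 (volume.restrict (Ioo a b)) := by
  obtain ⟨C, hC⟩ := isCompact_Icc.exists_bound_of_continuousOn hf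
  refine MemLp.of_bound
    ((hf.mono Ioo_subset_Icc_self).aestronglyMeasurable measurableSet_Ioo) C ?_
  exact ae_Ioo_of_forall fun t ht => hC t (Ioo_subset_Icc_self ht)

theorem MemW1.memLp {f : ℝ → ℝ} {a b : ℝ} (hab : a ≤ b) (hf : MemW1 f a b) :
    MemLp f 2 (volume.restrict (Ioo a b)) :=
  memLp_Ioo_of_continuousOn (hf.continuousOn hab)

theorem MemW1.mono {f : ℝ → ℝ} {a b c d : ℝ} (hac : a ≤ c) (hcd : c ≤ d) (hdb : d ≤ b)
    (hf : MemW1 f a b) : MemW1 f c d := by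
  refine ⟨hf.1.mono ?_, hf.2.mono_measure ?_⟩
  · rw [uIcc_of_le hcd, uIcc_of_le (by linarith)]; exact Icc_subset_Icc hac hdb
  · exact Measure.restrict_mono_set _ (Ioo_subset_Ioo hac hdb)

theorem MemW1.deriv_add {f g : ℝ → ℝ} {a b : ℝ} (hab : a ≤ b) (hf : MemW1 f a b)
    (hg : MemW1 g a b) : deriv (f + g) =ᵐ[volume.restrict (Ioo a b)] deriv f + deriv g := by
  filter_upwards [hf.ae_differentiableAt hab, hg.ae_differentiableAt hab] with t h1 h2
  exact _root_.deriv_add h1 h2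

theorem MemW1.add {f g : ℝ → ℝ} {a b : ℝ} (hab : a ≤ b) (hf : MemW1 f a b)
    (hg : MemW1 g a b) : MemW1 (f + g) a b :=
  ⟨hf.1.add hg.1, (hf.2.add hg.2).ae_eq (hf.deriv_add hab hg).symm⟩

theorem deriv_const_smul_fun (f : ℝ → ℝ) (c : ℝ) : deriv (c • f) = c • deriv f := by
  funext t
  have : c • f = fun x => c * f x := rfl
  rw [this, deriv_const_mul_field]
  rfl

theorem MemW1.const_smul {f : ℝ → ℝ} {a b : ℝ} (c : ℝ) (hf : MemW1 f a b) :
    MemW1 (c • f) a b := by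
  refine ⟨hf.1.const_smul c, ?_⟩
  rw [deriv_const_smul_fun]
  exact hf.2.const_smul c

theorem memW1_const (K a b : ℝ) : MemW1 (fun _ => K) a b := by
  refine ⟨?_, ?_⟩
  · exact (contDiff_const.contDiffOn).absolutelyContinuousOnInterval
  · simp

theorem MemW1.eq_add_integral {f : ℝ → ℝ} {a b t : ℝ} (hf : MemW1 f a b) (ht : t ∈ Icc a b) :
    f t = f a + ∫ s in a..t, deriv f s := by
  have := (hf.mono le_rfl ht.1 ht.2).1.integral_deriv_eq_sub
  linarith

/-- A primitive of a square integrable function belongs to `W_2^1`, and its derivative is that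
function almost everywhere. -/
theorem memW1_of_integral {f φ : ℝ → ℝ} {a b K : ℝ} (hab : a ≤ b)
    (hφ : MemLp φ 2 (volume.restrict (Ioo a b)))
    (h : ∀ t ∈ Icc a b, f t = K + ∫ s in a..t, φ s) :
    MemW1 f a b ∧ deriv f =ᵐ[volume.restrict (Ioo a b)] φ := by
  have hi := intervalIntegrable_of_memLp hab hφ
  have hd : deriv f =ᵐ[volume.restrict (Ioo a b)] φ := by
    have h1 : deriv f =ᵐ[volume.restrict (Ioo a b)] deriv (fun t => K + ∫ s in a..t, φ s) :=
      ae_Ioo_of_forall (deriv_eqOn_of_eqOn fun t ht => h t (Ioo_subset_Icc_self ht))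
    refine h1.trans ?_
    rw [Filter.EventuallyEq, ae_restrict_iff' measurableSet_Ioo]
    filter_upwards [hi.ae_hasDerivAt_integral] with t ht hm
    refine (HasDerivAt.const_add K (ht ?_ a ?_)).deriv
    · rw [uIcc_of_le hab]; exact Ioo_subset_Icc_self hm
    · simp
  refine ⟨⟨?_, hφ.ae_eq hd.symm⟩, hd⟩
  refine absolutelyContinuousOnInterval_congr (f := fun t => K + ∫ s in a..t, φ s) ?_ ?_
  · exact (memW1_const K a b).1.add
      (hi.absolutelyContinuousOnInterval_intervalIntegral (by simp))
  · rw [uIcc_of_le hab]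
    exact fun t ht => (h t ht).symm

theorem memLp_comp_affine {φ : ℝ → ℝ} {a b p d : ℝ} (hp : 0 < p)
    (hφ : MemLp φ 2 (volume.restrict (Ioo (p * a + d) (p * b + d)))) :
    MemLp (fun t => φ (p * t + d)) 2 (volume.restrict (Ioo a b)) := by
  have hm : Measurable fun t : ℝ => p * t + d := by fun_prop
  have hpre : Ioo a b = (fun t : ℝ => p * t + d) ⁻¹' Ioo (p * a + d) (p * b + d) := by
    ext t; simp [hp]
  have hmap : Measure.map (fun t : ℝ => p * t + d) (volume.restrict (Ioo a b))
      = ENNReal.ofReal |p⁻¹| • volume.restrict (Ioo (p * a + d) (p * b + d)) := by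
    rw [hpre, ← Measure.restrict_map hm measurableSet_Ioo, ← Measure.restrict_smul]
    congr 1
    have : (fun t : ℝ => p * t + d) = (fun t => t + d) ∘ fun t => p * t := rfl
    rw [this, ← Measure.map_map (by fun_prop) (by fun_prop), Real.map_volume_mul_left hp.ne',
      Measure.map_smul, (measurePreserving_add_right volume d).map_eq]
  refine MemLp.comp_of_map (f := fun t : ℝ => p * t + d) ?_ hm.aemeasurable
  rw [hmap]
  exact hφ.smul_measure ENNReal.ofReal_ne_top

theorem MemW1.comp_affine {f : ℝ → ℝ} {a b p d : ℝ} (hab : a ≤ b) (hp : 0 < p)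
    (hf : MemW1 f (p * a + d) (p * b + d)) : MemW1 (fun t => f (p * t + d)) a b := by
  refine (memW1_of_integral (φ := fun t => p * deriv f (p * t + d)) (K := f (p * a + d)) hab
    ((memLp_comp_affine hp hf.2).const_mul p) fun t ht => ?_).1
  rw [hf.eq_add_integral (t := p * t + d) ⟨by gcongr; exact ht.1, by gcongr; exact ht.2⟩,
    intervalIntegral.integral_const_mul, intervalIntegral.integral_comp_mul_add _ hp.ne']
  simp [hp.ne']

theorem memLp_glue {φ ψ : ℝ → ℝ} {a b c : ℝ}
    (hφ : MemLp φ 2 (volume.restrict (Ioo a c))) (hψ : MemLp ψ 2 (volume.restrict (Ioo c b))) :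
    MemLp (fun t => if t < c then φ t else ψ t) 2 (volume.restrict (Ioo a b)) := by
  refine MemLp.piecewise (s := Iio c) measurableSet_Iio ?_ ?_
  · rw [Measure.restrict_restrict measurableSet_Iio]
    refine hφ.mono_measure (Measure.restrict_mono_set _ ?_)
    exact fun t ht => ⟨ht.2.1, ht.1⟩
  · rw [Measure.restrict_restrict measurableSet_Iio.compl]
    rw [Measure.restrict_congr_set (Ioo_ae_eq_Ico (a := c) (b := b))] at hψ
    refine hψ.mono_measure (Measure.restrict_mono_set _ ?_)
    exact fun t ht => ⟨not_lt.1 ht.1, ht.2.2⟩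

theorem MemW1.glue {f g : ℝ → ℝ} {a b c : ℝ} (hac : a ≤ c) (hcb : c ≤ b) (hf : MemW1 f a c)
    (hg : MemW1 g c b) (h : f c = g c) : MemW1 (fun t => if t < c then f t else g t) a b := by
  have hφ := memLp_glue hf.2 hg.2
  have hi := intervalIntegrable_of_memLp (hac.trans hcb) hφ
  refine (memW1_of_integral (K := f a) (hac.trans hcb) hφ fun t ht => ?_).1
  have left : ∀ t ∈ Icc a c, ∫ s in a..t, (if s < c then deriv f s else deriv g s)
      = f t - f a := fun t ht => by
    rw [hf.eq_add_integral ht, add_sub_cancel_left]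
    refine intervalIntegral.integral_congr_Ioo_of_le ht.1 fun s hs => ?_
    exact if_pos (hs.2.trans_le ht.2)
  by_cases htc : t < c
  · rw [left t ⟨ht.1, htc.le⟩]; simp [htc]
  · have htc' := not_lt.1 htc
    rw [← intervalIntegral.integral_add_adjacent_intervals (b := c), left c ⟨hac, le_rfl⟩]
    · simp only [htc, if_false]
      rw [hg.eq_add_integral ⟨htc', ht.2⟩, h]
      have : ∫ s in c..t, (if s < c then deriv f s else deriv g s) = ∫ s in c..t, deriv g s :=
        intervalIntegral.integral_congr_Ioo_of_le htc' fun s hs => if_neg (not_lt.2 hs.1.le)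
      rw [this]; ring
    · refine hi.mono_set ?_
      rw [uIcc_of_le hac, uIcc_of_le (hac.trans hcb)]; exact Icc_subset_Icc le_rfl hcb
    · refine hi.mono_set ?_
      rw [uIcc_of_le htc', uIcc_of_le (hac.trans hcb)]; exact Icc_subset_Icc hac ht.2

theorem intervalIntegrable_mul {φ v : ℝ → ℝ} {a b : ℝ} (hab : a ≤ b)
    (hφ : MemLp φ 2 (volume.restrict (Ioo a b))) (hv : MemLp v 2 (volume.restrict (Ioo a b))) :
    IntervalIntegrable (fun t => φ t * v t) volume a b := by
  rw [intervalIntegrable_iff_integrableOn_Ioo_of_le hab]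
  exact hφ.integrable_mul hv

/-! ### States on the star graph -/

/-- The standing assumptions on the parameters. -/
structure Params.Admissible (P : Params n) : Prop where
  one_lt_q : 1 < P.q
  T_zero_pos : 0 < P.T 0
  lt_T_succ : ∀ k : Fin n, (P.q - 1) * P.T 0 < P.T k.succ
  α_pos : ∀ j, 0 < P.α j

theorem Params.l_zero (P : Params n) : P.l 0 = P.T 0 := rfl

theorem Params.l_succ (P : Params n) (k : Fin n) :
    P.l k.succ = P.q⁻¹ * (P.T k.succ - (P.q - 1) * P.T 0) := rfl

namespace Params.Admissible

variable {P : Params n} (hP : P.Admissible)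
include hP

theorem q_pos : 0 < P.q := one_pos.trans hP.one_lt_q

theorem q_inv_lt_one : P.q⁻¹ < 1 := inv_lt_one_of_one_lt₀ hP.one_lt_q

theorem T_pos (j : Fin (n + 1)) : 0 < P.T j := by
  refine Fin.cases hP.T_zero_pos (fun k => ?_) j
  exact (mul_pos (sub_pos.2 hP.one_lt_q) hP.T_zero_pos).trans (hP.lt_T_succ k)

theorem l_pos (j : Fin (n + 1)) : 0 < P.l j := by
  refine Fin.cases hP.T_zero_pos (fun k => ?_) j
  exact mul_pos (inv_pos.2 hP.q_pos) (sub_pos.2 (hP.lt_T_succ k))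

theorem q_mul_l (k : Fin n) : P.q * P.l k.succ = P.T k.succ - (P.q - 1) * P.T 0 := by
  rw [P.l_succ, mul_inv_cancel_left₀ hP.q_pos.ne']

theorem l_le_T (j : Fin (n + 1)) : P.l j ≤ P.T j := by
  refine Fin.cases le_rfl (fun k => ?_) j
  have h1 := hP.q_mul_l k
  have h2 := hP.one_lt_q
  have h3 := hP.T_zero_pos
  have h4 := hP.l_pos k.succ
  nlinarith

theorem q_inv_mul_T_le : P.q⁻¹ * P.T 0 ≤ P.T 0 :=
  mul_le_of_le_one_left hP.T_zero_pos.le hP.q_inv_lt_one.le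

theorem q_inv_mul_T_pos : 0 < P.q⁻¹ * P.T 0 := mul_pos (inv_pos.2 hP.q_pos) hP.T_zero_pos

end Params.Admissible

/-- The delayed values entering `ell`. -/
def delayed (P : Params n) (y : Fin (n + 1) → ℝ → ℝ) : Fin (n + 1) → ℝ → ℝ :=
  Fin.cons (fun t => y 0 (P.q⁻¹ * t))
    fun (k : Fin n) t => withHistory P y k (P.q⁻¹ * (t - (P.q - 1) * P.T 0))

theorem ell_eq (P : Params n) (y : Fin (n + 1) → ℝ → ℝ) (j : Fin (n + 1)) (t : ℝ) :
    ell P y j t = deriv (y j) t + P.b j * y j t + P.c j * delayed P y j t := by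
  revert t
  exact Fin.cases (fun _ => rfl) (fun _ _ => rfl) j

theorem withHistory_memW1 {P : Params n} (hP : P.Admissible) {y : Fin (n + 1) → ℝ → ℝ}
    (hy : MemW1Graph P y) (hc : ∀ k : Fin n, y k.succ 0 = y 0 (P.T 0)) (k : Fin n) :
    MemW1 (withHistory P y k) (P.q⁻¹ * P.T 0 - P.T 0) (P.T k.succ) := by
  have h0 := hP.q_inv_mul_T_le
  have h1 := hP.q_inv_mul_T_pos
  have hf : MemW1 (fun t => y 0 (1 * t + P.T 0)) (P.q⁻¹ * P.T 0 - P.T 0) 0 := by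
    refine MemW1.comp_affine (by linarith) one_pos ?_
    exact (hy 0).mono (by linarith) (by linarith) (by linarith)
  have := hf.glue (by linarith) (hP.T_pos k.succ).le (hy k.succ) (by simp [hc k])
  simp only [one_mul] at this
  exact this

theorem delayed_memW1 {P : Params n} (hP : P.Admissible) {y : Fin (n + 1) → ℝ → ℝ}
    (hy : MemW1Graph P y) (hc : ∀ k : Fin n, y k.succ 0 = y 0 (P.T 0)) (j : Fin (n + 1)) :
    MemW1 (delayed P y j) 0 (P.T j) := by
  have hq := inv_pos.2 hP.q_pos
  have h0 := hP.q_inv_mul_T_le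
  refine Fin.cases ?_ (fun k => ?_) j
  · have : MemW1 (fun t => y 0 (P.q⁻¹ * t + 0)) 0 (P.T 0) := by
      refine MemW1.comp_affine hP.T_zero_pos.le hq ?_
      exact (hy 0).mono (by simp) (by simpa using hP.q_inv_mul_T_pos.le) (by linarith)
    simp only [add_zero] at this
    exact this
  · have e : P.q⁻¹ * ((P.q - 1) * P.T 0) = P.T 0 - P.q⁻¹ * P.T 0 := by
      have := hP.q_pos.ne'
      field_simp
    have : MemW1 (fun t => withHistory P y k (P.q⁻¹ * t + (P.q⁻¹ * P.T 0 - P.T 0))) 0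
        (P.T k.succ) := by
      refine MemW1.comp_affine (hP.T_pos _).le hq ?_
      have h2 := hP.T_pos k.succ
      have h3 : P.q⁻¹ * P.T k.succ ≤ P.T k.succ :=
        mul_le_of_le_one_left h2.le hP.q_inv_lt_one.le
      refine (withHistory_memW1 hP hy hc k).mono (by simp) ?_ (by linarith)
      gcongr
    convert this using 2 with t
    change withHistory P y k _ = _
    congr 1
    rw [mul_sub, e]
    ring

theorem ell_memLp {P : Params n} (hP : P.Admissible) {y : Fin (n + 1) → ℝ → ℝ}
    (hy : MemW1Graph P y) (hc : ∀ k : Fin n, y k.succ 0 = y 0 (P.T 0)) (j : Fin (n + 1)) :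
    MemLp (ell P y j) 2 (volume.restrict (Ioo 0 (P.T j))) := by
  have h0 := (hP.T_pos j).le
  have := ((hy j).2.add (((hy j).memLp h0).const_mul (P.b j))).add
    (((delayed_memW1 hP hy hc j).memLp h0).const_mul (P.c j))
  refine this.ae_eq (Filter.Eventually.of_forall fun t => ?_)
  exact (ell_eq P y j t).symm

theorem delayed_add (P : Params n) (y z : Fin (n + 1) → ℝ → ℝ) :
    delayed P (y + z) = delayed P y + delayed P z := by
  funext j t
  refine Fin.cases rfl (fun k => ?_) j
  change withHistory P (y + z) k _ = withHistory P y k _ + withHistory P z k _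
  simp only [withHistory]
  split_ifs <;> rfl

theorem delayed_smul (P : Params n) (a : ℝ) (y : Fin (n + 1) → ℝ → ℝ) :
    delayed P (a • y) = a • delayed P y := by
  funext j t
  refine Fin.cases rfl (fun k => ?_) j
  change withHistory P (a • y) k _ = a • withHistory P y k _
  simp only [withHistory]
  split_ifs <;> rfl

theorem ell_smul (P : Params n) (a : ℝ) (y : Fin (n + 1) → ℝ → ℝ) :
    ell P (a • y) = a • ell P y := by
  funext j t
  simp only [Pi.smul_apply, ell_eq, delayed_smul, smul_eq_mul, deriv_const_smul_fun]
  ring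

theorem ell_add {P : Params n} (hP : P.Admissible) {y z : Fin (n + 1) → ℝ → ℝ}
    (hy : MemW1Graph P y) (hz : MemW1Graph P z) (j : Fin (n + 1)) :
    ell P (y + z) j =ᵐ[volume.restrict (Ioo 0 (P.T j))] ell P y j + ell P z j := by
  filter_upwards [(hy j).deriv_add (hP.T_pos j).le (hz j)] with t ht
  simp only [Pi.add_apply, ell_eq, delayed_add] at ht ⊢
  rw [ht]
  ring

/-- The Hilbert space `⨁ L_2(0, T_j)`. -/
abbrev L2Graph (P : Params n) : Type :=
  PiLp 2 fun j : Fin (n + 1) => Lp ℝ 2 (volume.restrict (Ioo 0 (P.T j)))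

/-- The class in `L2Graph` of a tuple of square integrable functions. -/
def toL2 (P : Params n) (f : Fin (n + 1) → ℝ → ℝ)
    (hf : ∀ j, MemLp (f j) 2 (volume.restrict (Ioo 0 (P.T j)))) : L2Graph P :=
  WithLp.toLp 2 fun j => (hf j).toLp

theorem inner_toL2 {P : Params n} (hP : P.Admissible) {f g : Fin (n + 1) → ℝ → ℝ}
    (hf : ∀ j, MemLp (f j) 2 (volume.restrict (Ioo 0 (P.T j))))
    (hg : ∀ j, MemLp (g j) 2 (volume.restrict (Ioo 0 (P.T j)))) :
    inner ℝ (toL2 P f hf) (toL2 P g hg) = ∑ j, ∫ t in (0 : ℝ)..P.T j, f j t * g j t := by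
  rw [PiLp.inner_apply]
  refine Finset.sum_congr rfl fun j _ => ?_
  rw [L2.inner_def, intervalIntegral.integral_of_le (hP.T_pos j).le, integral_Ioc_eq_integral_Ioo]
  refine integral_congr_ae ?_
  filter_upwards [(hf j).coeFn_toLp, (hg j).coeFn_toLp] with t h1 h2
  simp only [toL2]
  rw [h1, h2]
  simp [mul_comm]

theorem toL2_congr {P : Params n} {f g : Fin (n + 1) → ℝ → ℝ}
    (hf : ∀ j, MemLp (f j) 2 (volume.restrict (Ioo 0 (P.T j))))
    (hg : ∀ j, MemLp (g j) 2 (volume.restrict (Ioo 0 (P.T j))))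
    (h : ∀ j, f j =ᵐ[volume.restrict (Ioo 0 (P.T j))] g j) : toL2 P f hf = toL2 P g hg :=
  PiLp.ext fun j => MemLp.toLp_congr (hf j) (hg j) (h j)

theorem toL2_add {P : Params n} {f g : Fin (n + 1) → ℝ → ℝ}
    (hf : ∀ j, MemLp (f j) 2 (volume.restrict (Ioo 0 (P.T j))))
    (hg : ∀ j, MemLp (g j) 2 (volume.restrict (Ioo 0 (P.T j)))) :
    toL2 P f hf + toL2 P g hg = toL2 P (f + g) fun j => (hf j).add (hg j) :=
  PiLp.ext fun j => (MemLp.toLp_add (hf j) (hg j)).symm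

theorem toL2_smul {P : Params n} {f : Fin (n + 1) → ℝ → ℝ} (a : ℝ)
    (hf : ∀ j, MemLp (f j) 2 (volume.restrict (Ioo 0 (P.T j)))) :
    a • toL2 P f hf = toL2 P (a • f) fun j => (hf j).const_smul a :=
  PiLp.ext fun j => (MemLp.toLp_const_smul a (hf j)).symm

/-- The functions of `W_2^1` on the graph that are continuous at the internal vertex. -/
def states (P : Params n) (hP : P.Admissible) : Submodule ℝ (Fin (n + 1) → ℝ → ℝ) where
  carrier := {y | MemW1Graph P y ∧ ∀ k : Fin n, y k.succ 0 = y 0 (P.T 0)}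
  add_mem' := fun ha hb =>
    ⟨fun j => (ha.1 j).add (hP.T_pos j).le (hb.1 j), fun k => by simp [ha.2 k, hb.2 k]⟩
  zero_mem' := ⟨fun j => memW1_const 0 _ _, fun k => rfl⟩
  smul_mem' := fun c _ ha => ⟨fun j => (ha.1 j).const_smul c, fun k => by simp [ha.2 k]⟩

/-- The admissible variations: the states that vanish at the origin and satisfy the rest
condition. -/
def variations (P : Params n) (hP : P.Admissible) : Submodule ℝ (states P hP) where
  carrier := {v | v.1 0 0 = 0 ∧ ∀ k : Fin n, ∀ t ∈ Icc (P.l k.succ) (P.T k.succ), v.1 k.succ t = 0}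
  add_mem' := fun ha hb =>
    ⟨by simp [ha.1, hb.1], fun k t ht => by simp [ha.2 k t ht, hb.2 k t ht]⟩
  zero_mem' := ⟨rfl, fun k t _ => rfl⟩
  smul_mem' := fun c _ ha => ⟨by simp [ha.1], fun k t ht => by simp [ha.2 k t ht]⟩

theorem states.ell_memLp {P : Params n} {hP : P.Admissible} (y : states P hP) (j : Fin (n + 1)) :
    MemLp (ell P y.1 j) 2 (volume.restrict (Ioo 0 (P.T j))) :=
  StarGraph.ell_memLp hP y.2.1 y.2.2 j

/-- The tuple of derivatives. -/
def derivMap (P : Params n) (hP : P.Admissible) : states P hP →ₗ[ℝ] L2Graph P where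
  toFun y := toL2 P (fun j => deriv (y.1 j)) fun j => (y.2.1 j).2
  map_add' y z := by
    rw [toL2_add]
    exact toL2_congr _ _ fun j => (y.2.1 j).deriv_add (hP.T_pos j).le (z.2.1 j)
  map_smul' a y := by
    rw [RingHom.id_apply, toL2_smul]
    exact toL2_congr _ _ fun j => Filter.EventuallyEq.of_eq (deriv_const_smul_fun _ _)

/-- The tuple of the functions `√α_j ℓ_j y`; the square of its norm is the energy. -/
def ellMap (P : Params n) (hP : P.Admissible) : states P hP →ₗ[ℝ] L2Graph P where
  toFun y := toL2 P (fun j => √(P.α j) • ell P y.1 j) fun j => (states.ell_memLp y j).const_smul _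
  map_add' y z := by
    rw [toL2_add]
    refine toL2_congr _ _ fun j => ?_
    filter_upwards [ell_add hP y.2.1 z.2.1 j] with t ht
    change √(P.α j) * ell P (y.1 + z.1) j t = √(P.α j) * _ + √(P.α j) * _
    rw [ht, Pi.add_apply, mul_add]
  map_smul' a y := by
    rw [RingHom.id_apply, toL2_smul]
    refine toL2_congr _ _ fun j => Filter.EventuallyEq.of_eq ?_
    change √(P.α j) • ell P (a • y.1) j = a • (√(P.α j) • ell P y.1 j)
    rw [ell_smul, Pi.smul_apply, smul_comm]

theorem inner_ellMap {P : Params n} {hP : P.Admissible} (y z : states P hP) :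
    inner ℝ (ellMap P hP y) (ellMap P hP z)
      = ∑ j, P.α j * ∫ t in (0 : ℝ)..P.T j, ell P y.1 j t * ell P z.1 j t := by
  change inner ℝ (toL2 P _ _) (toL2 P _ _) = _
  rw [inner_toL2 hP]
  refine Finset.sum_congr rfl fun j _ => ?_
  rw [← intervalIntegral.integral_const_mul]
  congr 1
  funext t
  simp only [Pi.smul_apply, smul_eq_mul]
  have := Real.mul_self_sqrt (hP.α_pos j).le
  linear_combination (ell P y.1 j t * ell P z.1 j t) * this

theorem norm_ellMap_sq {P : Params n} {hP : P.Admissible} (y : states P hP) :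
    ‖ellMap P hP y‖ ^ 2 = energy P y.1 := by
  rw [← real_inner_self_eq_norm_sq, inner_ellMap]
  simp only [energy, sq]

/-! ### A priori estimates -/

theorem norm_toL2_le_mul {P : Params n} {f g : Fin (n + 1) → ℝ → ℝ} {c : ℝ} (hc : 0 ≤ c)
    (hf : ∀ j, MemLp (f j) 2 (volume.restrict (Ioo 0 (P.T j))))
    (hg : ∀ j, MemLp (g j) 2 (volume.restrict (Ioo 0 (P.T j))))
    (h : ∀ j, ∀ t ∈ Ioo 0 (P.T j), |f j t| ≤ c * |g j t|) :
    ‖toL2 P f hf‖ ≤ c * ‖toL2 P g hg‖ := by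
  refine le_of_sq_le_sq ?_ (by positivity)
  rw [mul_pow, PiLp.norm_sq_eq_of_L2, PiLp.norm_sq_eq_of_L2, Finset.mul_sum]
  refine Finset.sum_le_sum fun j _ => ?_
  rw [← mul_pow]
  refine pow_le_pow_left₀ (norm_nonneg _) (Lp.norm_le_mul_norm_of_ae_le_mul ?_) 2
  filter_upwards [(hf j).coeFn_toLp, (hg j).coeFn_toLp, ae_Ioo_of_forall (h j)] with t h1 h2 h3
  simp only [toL2]
  rw [h1, h2]
  exact h3

/-- The norm of the constant function `1` on the graph. -/
def normOne (P : Params n) : ℝ := ‖toL2 P (fun _ _ => 1) fun _ => memLp_const 1‖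

theorem normOne_nonneg (P : Params n) : 0 ≤ normOne P := norm_nonneg _

theorem norm_toL2_le_of_bound {P : Params n} {f : Fin (n + 1) → ℝ → ℝ} {M : ℝ} (hM : 0 ≤ M)
    (hf : ∀ j, MemLp (f j) 2 (volume.restrict (Ioo 0 (P.T j))))
    (h : ∀ j, ∀ t ∈ Ioo 0 (P.T j), |f j t| ≤ M) : ‖toL2 P f hf‖ ≤ M * normOne P :=
  norm_toL2_le_mul hM hf (fun _ => memLp_const 1) fun j t ht => by simpa using h j t ht

theorem sum_integral_abs_le {P : Params n} (hP : P.Admissible) {f : Fin (n + 1) → ℝ → ℝ}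
    (hf : ∀ j, MemLp (f j) 2 (volume.restrict (Ioo 0 (P.T j)))) :
    ∑ j, ∫ t in (0 : ℝ)..P.T j, |f j t| ≤ normOne P * ‖toL2 P f hf‖ := by
  have habs : ∀ j, MemLp (fun t => |f j t|) 2 (volume.restrict (Ioo 0 (P.T j))) :=
    fun j => (hf j).norm
  have h1 := inner_toL2 hP (f := fun _ _ => 1) (fun _ => memLp_const 1) habs
  have h2 : ‖toL2 P (fun j t => |f j t|) habs‖ ≤ 1 * ‖toL2 P f hf‖ :=
    norm_toL2_le_mul zero_le_one habs hf fun j t _ => by simp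
  simp only [one_mul] at h1 h2
  rw [← h1]
  exact (real_inner_le_norm _ _).trans (mul_le_mul_of_nonneg_left h2 (norm_nonneg _))

/-- The time that elapses before the process enters the edge. -/
def Params.entry (P : Params n) : Fin (n + 1) → ℝ := Fin.cons 0 fun _ => P.T 0

/-- An exponential bound in the total elapsed time is inherited by the delayed values, since the
delay decreases the total elapsed time. -/
theorem abs_delayed_le {P : Params n} (hP : P.Admissible) {y : Fin (n + 1) → ℝ → ℝ} {N r : ℝ}
    (hN : 0 ≤ N) (hr : 0 ≤ r)
    (h : ∀ j, ∀ t ∈ Icc 0 (P.T j), |y j t| ≤ N * Real.exp (r * (t + P.entry j)))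
    (j : Fin (n + 1)) (t : ℝ) (ht : t ∈ Icc 0 (P.T j)) :
    |delayed P y j t| ≤ N * Real.exp (r * (t + P.entry j)) := by
  have hq := inv_pos.2 hP.q_pos
  have hq1 := hP.q_inv_lt_one
  have h0 := hP.T_zero_pos
  have key : ∀ i s, s ∈ Icc 0 (P.T i) → s + P.entry i ≤ t + P.entry j →
      |y i s| ≤ N * Real.exp (r * (t + P.entry j)) := fun i s hs hle => by
    refine (h i s hs).trans ?_
    gcongr
  revert ht key
  refine Fin.cases (fun ht key => ?_) (fun k ht key => ?_) j
  · have : P.q⁻¹ * t ≤ t := mul_le_of_le_one_left ht.1 hq1.le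
    exact key 0 _ ⟨mul_nonneg hq.le ht.1, this.trans ht.2⟩ (by gcongr)
  · change |withHistory P y k _| ≤ _
    have e : P.q⁻¹ * (t - (P.q - 1) * P.T 0) = P.q⁻¹ * t - P.T 0 + P.q⁻¹ * P.T 0 := by
      have := hP.q_pos.ne'
      field_simp
      ring
    have h1 : P.q⁻¹ * t ≤ t := mul_le_of_le_one_left ht.1 hq1.le
    have h2 : 0 ≤ P.q⁻¹ * t := mul_nonneg hq.le ht.1
    have h3 := hP.q_inv_mul_T_le
    have h4 := hP.q_inv_mul_T_pos
    have e0 : P.entry 0 = 0 := rfl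
    have ek : P.entry k.succ = P.T 0 := rfl
    rw [e]
    unfold withHistory
    split_ifs with hs
    · refine key 0 _ ⟨by linarith, by linarith⟩ ?_
      rw [e0, ek]
      linarith
    · refine key k.succ _ ⟨by linarith, ?_⟩ ?_
      · linarith [ht.2]
      · linarith

/-- A uniform bound is inherited by the delayed values. -/
theorem abs_delayed_le_const {P : Params n} (hP : P.Admissible) {y : Fin (n + 1) → ℝ → ℝ} {M : ℝ}
    (hM : 0 ≤ M) (h : ∀ j, ∀ t ∈ Icc 0 (P.T j), |y j t| ≤ M)
    (j : Fin (n + 1)) (t : ℝ) (ht : t ∈ Icc 0 (P.T j)) : |delayed P y j t| ≤ M := by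
  have := abs_delayed_le hP hM le_rfl (y := y) (fun j t ht => by simpa using h j t ht) j t ht
  simpa using this

/-- A bound for the total size of the coefficients. -/
def Params.coeffBound (P : Params n) : ℝ := 1 + ∑ j, (|P.b j| + |P.c j|)

theorem Params.abs_add_abs_le (P : Params n) (j : Fin (n + 1)) :
    |P.b j| + |P.c j| ≤ P.coeffBound := by
  have := Finset.single_le_sum (f := fun j => |P.b j| + |P.c j|)
    (fun i _ => by positivity) (Finset.mem_univ j)
  simp only [Params.coeffBound]
  linarith

theorem Params.coeffBound_pos (P : Params n) : 0 < P.coeffBound := by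
  unfold Params.coeffBound
  positivity

theorem abs_lowerOrder_le (P : Params n) (j : Fin (n + 1)) {u v M : ℝ} (hu : |u| ≤ M)
    (hv : |v| ≤ M) : |P.b j * u + P.c j * v| ≤ P.coeffBound * M := by
  have hM : 0 ≤ M := (abs_nonneg u).trans hu
  calc |P.b j * u + P.c j * v| ≤ |P.b j * u| + |P.c j * v| := abs_add_le _ _
    _ = |P.b j| * |u| + |P.c j| * |v| := by rw [abs_mul, abs_mul]
    _ ≤ |P.b j| * M + |P.c j| * M := by gcongr
    _ = (|P.b j| + |P.c j|) * M := by ring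
    _ ≤ P.coeffBound * M := by gcongr; exact P.abs_add_abs_le j

theorem integral_abs_le_sum {P : Params n} (hP : P.Admissible) {f : Fin (n + 1) → ℝ → ℝ}
    (hf : ∀ j, MemLp (f j) 2 (volume.restrict (Ioo 0 (P.T j)))) (j : Fin (n + 1)) {t : ℝ}
    (ht : t ∈ Icc 0 (P.T j)) :
    ∫ s in (0 : ℝ)..t, |f j s| ≤ ∑ j, ∫ t in (0 : ℝ)..P.T j, |f j t| := by
  refine (intervalIntegral.integral_mono_interval le_rfl ht.1 ht.2 ?_ ?_).trans
    (Finset.single_le_sum (f := fun j => ∫ t in (0 : ℝ)..P.T j, |f j t|) ?_ (Finset.mem_univ j))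
  · exact Filter.Eventually.of_forall fun _ => abs_nonneg _
  · exact intervalIntegrable_of_memLp (hP.T_pos j).le (hf j).norm
  · intro i _
    exact intervalIntegral.integral_nonneg (hP.T_pos i).le fun _ _ => abs_nonneg _

theorem abs_increment_le {P : Params n} {hP : P.Admissible} (y : states P hP) {N r : ℝ}
    (hN : 0 ≤ N) (hr : r = 2 * P.coeffBound)
    (h : ∀ j, ∀ t ∈ Icc 0 (P.T j), |y.1 j t| ≤ N * Real.exp (r * (t + P.entry j)))
    (j : Fin (n + 1)) {t : ℝ} (ht : t ∈ Icc 0 (P.T j)) :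
    |y.1 j t - y.1 j 0| ≤ (∑ j, ∫ t in (0 : ℝ)..P.T j, |ell P y.1 j t|)
      + N / 2 * (Real.exp (r * (t + P.entry j)) - Real.exp (r * P.entry j)) := by
  have hκ := P.coeffBound_pos
  have hr0 : 0 < r := by rw [hr]; positivity
  have hell : IntervalIntegrable (fun s => |ell P y.1 j s|) volume 0 t := by
    refine (intervalIntegrable_of_memLp (hP.T_pos j).le (states.ell_memLp y j)).abs.mono_set ?_
    rw [uIcc_of_le ht.1, uIcc_of_le (hP.T_pos j).le]
    exact Icc_subset_Icc le_rfl ht.2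
  have hexp : Continuous fun s => P.coeffBound * (N * Real.exp (r * (s + P.entry j))) := by
    fun_prop
  have hint : ∫ s in (0 : ℝ)..t, P.coeffBound * (N * Real.exp (r * (s + P.entry j)))
      = N / 2 * (Real.exp (r * (t + P.entry j)) - Real.exp (r * P.entry j)) := by
    have hd : ∀ s ∈ uIcc 0 t, HasDerivAt (fun s => N / 2 * Real.exp (r * (s + P.entry j)))
        (P.coeffBound * (N * Real.exp (r * (s + P.entry j)))) s := fun s _ => by
      have := ((((hasDerivAt_id s).add_const (P.entry j)).const_mul r).exp).const_mul (N / 2)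
      refine this.congr_deriv ?_
      rw [hr, id_eq]
      ring
    rw [intervalIntegral.integral_eq_sub_of_hasDerivAt hd (hexp.intervalIntegrable _ _), zero_add,
      mul_sub]
  rw [(y.2.1 j).eq_add_integral ht, add_sub_cancel_left, ← hint]
  have h1 : ∫ s in (0 : ℝ)..t, |ell P y.1 j s| ≤ _ :=
    integral_abs_le_sum hP (states.ell_memLp y) j ht
  refine le_trans ?_ (add_le_add_left h1 _)
  rw [← intervalIntegral.integral_add hell (hexp.intervalIntegrable _ _)]
  rw [← Real.norm_eq_abs]
  refine intervalIntegral.norm_integral_le_of_norm_le ht.1 ?_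
    (hell.add (hexp.intervalIntegrable _ _))
  refine Filter.Eventually.of_forall fun s hs => ?_
  have hs' : s ∈ Icc 0 (P.T j) := ⟨hs.1.le, hs.2.trans ht.2⟩
  have h2 := abs_lowerOrder_le P j (h j s hs') (abs_delayed_le hP hN hr0.le h j s hs')
  have h3 : deriv (y.1 j) s = ell P y.1 j s - (P.b j * y.1 j s + P.c j * delayed P y.1 j s) := by
    rw [ell_eq]; ring
  rw [Real.norm_eq_abs, h3]
  exact (abs_sub _ _).trans (by gcongr)

/-- A state that vanishes at the origin is controlled by `ell`. The weight `exp (2 κ t)`, with `t`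
the total elapsed time, makes the lower order terms contribute at most one half of the bound. -/
theorem exists_sup_bound (P : Params n) (hP : P.Admissible) :
    ∃ C, 0 ≤ C ∧ ∀ y : states P hP, y.1 0 0 = 0 → ∀ j, ∀ t ∈ Icc 0 (P.T j),
      |y.1 j t| ≤ C * ∑ i, ∫ t in (0 : ℝ)..P.T i, |ell P y.1 i t| := by
  set r := 2 * P.coeffBound with hr
  have hr0 : 0 < r := mul_pos two_pos P.coeffBound_pos
  have he : ∀ j, 0 ≤ P.entry j := Fin.cases le_rfl fun k => hP.T_zero_pos.le
  refine ⟨∑ j, 4 * Real.exp (r * (P.T j + P.entry j)), by positivity, fun y hy j t ht => ?_⟩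
  set F := ∑ i, ∫ t in (0 : ℝ)..P.T i, |ell P y.1 i t| with hF
  have hF0 : 0 ≤ F := Finset.sum_nonneg fun i _ =>
    intervalIntegral.integral_nonneg (hP.T_pos i).le fun _ _ => abs_nonneg _
  have one_le : ∀ j, ∀ t ∈ Icc 0 (P.T j), 1 ≤ Real.exp (r * (t + P.entry j)) := fun j t ht =>
    Real.one_le_exp (mul_nonneg hr0.le (add_nonneg ht.1 (he j)))
  have step : ∀ N, 0 ≤ N →
      (∀ j, ∀ t ∈ Icc 0 (P.T j), |y.1 j t| ≤ N * Real.exp (r * (t + P.entry j))) →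
      ∀ j, ∀ t ∈ Icc 0 (P.T j), |y.1 j t| ≤ (2 * F + N / 2) * Real.exp (r * (t + P.entry j)) := by
    intro N hN h
    have h0 : ∀ t ∈ Icc 0 (P.T 0), |y.1 0 t| ≤ F + N / 2 * Real.exp (r * t) := fun t ht => by
      have := abs_increment_le y hN hr h 0 ht
      have e0 : P.entry 0 = 0 := rfl
      rw [hy, sub_zero, e0, add_zero, mul_zero, Real.exp_zero] at this
      linarith
    refine Fin.cases (fun t ht => ?_) fun k t ht => ?_
    · have h1 := h0 t ht
      have h2 := one_le 0 t ht
      have e0 : P.entry 0 = 0 := rfl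
      rw [e0, add_zero] at h2 ⊢
      nlinarith
    · have h1 := h0 (P.T 0) ⟨hP.T_zero_pos.le, le_rfl⟩
      have h2 := one_le k.succ t ht
      have h3 := abs_increment_le y hN hr h k.succ ht
      have ek : P.entry k.succ = P.T 0 := rfl
      rw [ek] at h2 h3 ⊢
      rw [y.2.2 k] at h3
      have h4 := abs_add_le (y.1 k.succ t - y.1 0 (P.T 0)) (y.1 0 (P.T 0))
      rw [sub_add_cancel] at h4
      nlinarith
  obtain ⟨N, hN, h⟩ : ∃ N, 0 ≤ N ∧ ∀ j, ∀ t ∈ Icc 0 (P.T j),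
      |y.1 j t| ≤ (4 * F + N) * Real.exp (r * (t + P.entry j)) := by
    have hb : ∀ j, ∃ C, ∀ t ∈ Icc 0 (P.T j), ‖y.1 j t‖ ≤ C := fun j =>
      isCompact_Icc.exists_bound_of_continuousOn ((y.2.1 j).continuousOn (hP.T_pos j).le)
    choose B hB using hb
    have hB0 : ∀ j, 0 ≤ B j := fun j =>
      (norm_nonneg _).trans (hB j 0 ⟨le_rfl, (hP.T_pos j).le⟩)
    refine ⟨∑ j, B j, Finset.sum_nonneg fun j _ => hB0 j, fun j t ht => ?_⟩
    have h1 := hB j t ht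
    have h2 := Finset.single_le_sum (fun i _ => hB0 i) (Finset.mem_univ j)
    have h3 := one_le j t ht
    have h4 : 0 ≤ ∑ j, B j := Finset.sum_nonneg fun j _ => hB0 j
    rw [Real.norm_eq_abs] at h1
    nlinarith
  -- The value `4 * F` is the fixed point of `N ↦ 2 * F + N / 2`.
  have iter : ∀ m : ℕ, ∀ j, ∀ t ∈ Icc 0 (P.T j),
      |y.1 j t| ≤ (4 * F + N * (1 / 2) ^ m) * Real.exp (r * (t + P.entry j)) := by
    intro m
    induction m with
    | zero => simpa using h
    | succ m ih =>
      intro j t ht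
      refine (step _ (by positivity) ih j t ht).trans (le_of_eq ?_)
      rw [pow_succ]
      ring
  have lim : Filter.Tendsto (fun m : ℕ => (4 * F + N * (1 / 2) ^ m)
      * Real.exp (r * (t + P.entry j))) Filter.atTop
      (nhds ((4 * F + N * 0) * Real.exp (r * (t + P.entry j)))) := by
    refine Filter.Tendsto.mul_const _ (Filter.Tendsto.const_add _ (Filter.Tendsto.const_mul _ ?_))
    exact tendsto_pow_atTop_nhds_zero_of_lt_one (by norm_num) (by norm_num)
  have h1 := ge_of_tendsto' lim fun m => iter m j t ht
  have h2 : 4 * Real.exp (r * (P.T j + P.entry j))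
      ≤ ∑ j, 4 * Real.exp (r * (P.T j + P.entry j)) :=
    Finset.single_le_sum (f := fun j => 4 * Real.exp (r * (P.T j + P.entry j)))
      (fun i _ => by positivity) (Finset.mem_univ j)
  have h3 : Real.exp (r * (t + P.entry j)) ≤ Real.exp (r * (P.T j + P.entry j)) := by
    gcongr
    exact ht.2
  calc |y.1 j t| ≤ 4 * Real.exp (r * (t + P.entry j)) * F := by linarith
    _ ≤ (∑ j, 4 * Real.exp (r * (P.T j + P.entry j))) * F := by
      gcongr
      linarith

theorem abs_le_two_mul_sum_integral_deriv {P : Params n} {hP : P.Admissible} (y : states P hP)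
    (hy : y.1 0 0 = 0) (j : Fin (n + 1)) (t : ℝ) (ht : t ∈ Icc 0 (P.T j)) :
    |y.1 j t| ≤ 2 * ∑ i, ∫ t in (0 : ℝ)..P.T i, |deriv (y.1 i) t| := by
  have inc : ∀ j, ∀ t ∈ Icc 0 (P.T j),
      |y.1 j t - y.1 j 0| ≤ ∑ i, ∫ t in (0 : ℝ)..P.T i, |deriv (y.1 i) t| := fun j t ht => by
    rw [(y.2.1 j).eq_add_integral ht, add_sub_cancel_left]
    exact (intervalIntegral.abs_integral_le_integral_abs ht.1).trans
      (integral_abs_le_sum hP (f := fun j => deriv (y.1 j)) (fun j => (y.2.1 j).2) j ht)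
  have h0 := inc 0 (P.T 0) ⟨hP.T_zero_pos.le, le_rfl⟩
  rw [hy, sub_zero] at h0
  revert t
  refine Fin.cases (fun t ht => ?_) (fun k t ht => ?_) j
  · have := inc 0 t ht
    rw [hy, sub_zero] at this
    linarith [abs_nonneg (y.1 0 t)]
  · have h1 := inc k.succ t ht
    rw [y.2.2 k] at h1
    have h2 := abs_add_le (y.1 k.succ t - y.1 0 (P.T 0)) (y.1 0 (P.T 0))
    rw [sub_add_cancel] at h2
    linarith

theorem lowerOrder_memLp {P : Params n} {hP : P.Admissible} (y : states P hP) (j : Fin (n + 1)) :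
    MemLp (fun t => P.b j * y.1 j t + P.c j * delayed P y.1 j t) 2
      (volume.restrict (Ioo 0 (P.T j))) :=
  (((y.2.1 j).memLp (hP.T_pos j).le).const_mul _).add
    (((delayed_memW1 hP y.2.1 y.2.2 j).memLp (hP.T_pos j).le).const_mul _)

theorem norm_lowerOrder_le {P : Params n} {hP : P.Admissible} (y : states P hP) {M : ℝ}
    (hM : 0 ≤ M) (h : ∀ j, ∀ t ∈ Icc 0 (P.T j), |y.1 j t| ≤ M) :
    ‖toL2 P _ (lowerOrder_memLp y)‖ ≤ P.coeffBound * M * normOne P := by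
  refine norm_toL2_le_of_bound (mul_nonneg P.coeffBound_pos.le hM) _ fun j t ht => ?_
  have ht' := Ioo_subset_Icc_self ht
  exact abs_lowerOrder_le P j (h j t ht') (abs_delayed_le_const hP hM h j t ht')

theorem toL2_ell_eq {P : Params n} {hP : P.Admissible} (y : states P hP) :
    toL2 P (ell P y.1) (states.ell_memLp y)
      = derivMap P hP y + toL2 P _ (lowerOrder_memLp y) := by
  change _ = toL2 P _ _ + _
  rw [toL2_add]
  refine toL2_congr _ _ fun j => Filter.Eventually.of_forall fun t => ?_
  rw [ell_eq]
  simp only [Pi.add_apply]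
  ring

theorem exists_norm_toL2_ell_le (P : Params n) (hP : P.Admissible) :
    ∃ C, 0 ≤ C ∧ ∀ y : states P hP,
      ‖toL2 P (ell P y.1) (states.ell_memLp y)‖ ≤ C * ‖ellMap P hP y‖ := by
  refine ⟨∑ j, (√(P.α j))⁻¹, by positivity, fun y => ?_⟩
  change _ ≤ _ * ‖toL2 P _ _‖
  refine norm_toL2_le_mul (by positivity) _ _ fun j t _ => ?_
  have h1 := Real.sqrt_pos.2 (hP.α_pos j)
  have h2 : (√(P.α j))⁻¹ ≤ ∑ j, (√(P.α j))⁻¹ :=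
    Finset.single_le_sum (f := fun j => (√(P.α j))⁻¹) (fun i _ => by positivity)
      (Finset.mem_univ j)
  rw [Pi.smul_apply, smul_eq_mul, abs_mul, abs_of_pos h1, ← mul_assoc]
  refine le_mul_of_one_le_left (abs_nonneg _) ?_
  rw [← inv_mul_cancel₀ h1.ne']
  gcongr

theorem exists_norm_ellMap_le_norm_toL2 (P : Params n) (hP : P.Admissible) :
    ∃ C, 0 ≤ C ∧ ∀ y : states P hP,
      ‖ellMap P hP y‖ ≤ C * ‖toL2 P (ell P y.1) (states.ell_memLp y)‖ := by
  refine ⟨∑ j, √(P.α j), by positivity, fun y => ?_⟩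
  change ‖toL2 P _ _‖ ≤ _
  refine norm_toL2_le_mul (by positivity) _ _ fun j t _ => ?_
  have h2 : √(P.α j) ≤ ∑ j, √(P.α j) :=
    Finset.single_le_sum (f := fun j => √(P.α j)) (fun i _ => by positivity) (Finset.mem_univ j)
  rw [Pi.smul_apply, smul_eq_mul, abs_mul, abs_of_nonneg (Real.sqrt_nonneg _)]
  gcongr

/-- Coercivity of the energy on the states that vanish at the origin. -/
theorem exists_norm_derivMap_le (P : Params n) (hP : P.Admissible) :
    ∃ C, 0 ≤ C ∧ ∀ y : states P hP, y.1 0 0 = 0 → ‖derivMap P hP y‖ ≤ C * ‖ellMap P hP y‖ := by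
  obtain ⟨A, hA, h1⟩ := exists_sup_bound P hP
  obtain ⟨B, hB, h2⟩ := exists_norm_toL2_ell_le P hP
  have hn := normOne_nonneg P
  have hκ := P.coeffBound_pos
  refine ⟨(1 + P.coeffBound * (A * normOne P) * normOne P) * B, by positivity, fun y hy => ?_⟩
  have h3 := h2 y
  set E := ‖toL2 P (ell P y.1) (states.ell_memLp y)‖ with hE
  have hE0 : 0 ≤ E := norm_nonneg _
  have h4 := sum_integral_abs_le hP (states.ell_memLp y)
  have h5 := norm_lowerOrder_le y (M := A * (normOne P * E)) (by positivity) fun j t ht =>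
    (h1 y hy j t ht).trans (by gcongr)
  have h6 : derivMap P hP y = toL2 P (ell P y.1) (states.ell_memLp y)
      - toL2 P _ (lowerOrder_memLp y) := by rw [toL2_ell_eq, add_sub_cancel_right]
  calc ‖derivMap P hP y‖ ≤ E + P.coeffBound * (A * (normOne P * E)) * normOne P := by
        rw [h6]
        exact (norm_sub_le _ _).trans (by gcongr)
    _ = (1 + P.coeffBound * (A * normOne P) * normOne P) * E := by ring
    _ ≤ (1 + P.coeffBound * (A * normOne P) * normOne P) * (B * ‖ellMap P hP y‖) := by gcongr
    _ = _ := by ring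

/-- Boundedness of the energy on the states that vanish at the origin. -/
theorem exists_norm_ellMap_le (P : Params n) (hP : P.Admissible) :
    ∃ C, 0 ≤ C ∧ ∀ y : states P hP, y.1 0 0 = 0 → ‖ellMap P hP y‖ ≤ C * ‖derivMap P hP y‖ := by
  obtain ⟨B, hB, h2⟩ := exists_norm_ellMap_le_norm_toL2 P hP
  have hn := normOne_nonneg P
  have hκ := P.coeffBound_pos
  refine ⟨B * (1 + P.coeffBound * (2 * normOne P) * normOne P), by positivity, fun y hy => ?_⟩
  have h4 : _ ≤ normOne P * ‖derivMap P hP y‖ :=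
    sum_integral_abs_le hP (f := fun j => deriv (y.1 j)) fun j => (y.2.1 j).2
  have h5 := norm_lowerOrder_le y (M := 2 * (normOne P * ‖derivMap P hP y‖)) (by positivity)
    fun j t ht => (abs_le_two_mul_sum_integral_deriv y hy j t ht).trans (by gcongr)
  calc ‖ellMap P hP y‖ ≤ B * ‖toL2 P (ell P y.1) (states.ell_memLp y)‖ := h2 y
    _ ≤ B * (‖derivMap P hP y‖
        + P.coeffBound * (2 * (normOne P * ‖derivMap P hP y‖)) * normOne P) := by
        rw [toL2_ell_eq]
        gcongr
        exact (norm_add_le _ _).trans (by gcongr)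
    _ = _ := by ring

/-- A state that vanishes at the origin and has zero energy is zero. -/
theorem eqOnGraph_zero_of_ellMap_eq_zero {P : Params n} {hP : P.Admissible} (y : states P hP)
    (hy : y.1 0 0 = 0) (h : ellMap P hP y = 0) : EqOnGraph P y.1 0 := by
  obtain ⟨C, _, hC⟩ := exists_norm_derivMap_le P hP
  have h1 : ‖derivMap P hP y‖ ≤ 0 := by simpa [h] using hC y hy
  have h2 : _ ≤ normOne P * ‖derivMap P hP y‖ :=
    sum_integral_abs_le hP (f := fun j => deriv (y.1 j)) fun j => (y.2.1 j).2
  rw [le_antisymm h1 (norm_nonneg _), mul_zero] at h2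
  intro j t ht
  have h3 := abs_le_two_mul_sum_integral_deriv y hy j t ht
  exact abs_nonpos_iff.1 (by linarith)

/-! ### The orthogonal projection -/

theorem integral_congr_ae_Ioo {f g : ℝ → ℝ} {a b c d : ℝ} (hac : a ≤ c) (hcd : c ≤ d) (hdb : d ≤ b)
    (h : f =ᵐ[volume.restrict (Ioo a b)] g) : ∫ s in c..d, f s = ∫ s in c..d, g s := by
  rw [intervalIntegral.integral_of_le hcd, intervalIntegral.integral_of_le hcd,
    integral_Ioc_eq_integral_Ioo, integral_Ioc_eq_integral_Ioo]
  exact integral_congr_ae (ae_restrict_of_ae_restrict_of_subset (Ioo_subset_Ioo hac hdb) h)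

theorem continuous_integral_apply (P : Params n) (j : Fin (n + 1)) {t : ℝ}
    (ht : t ∈ Icc 0 (P.T j)) : Continuous fun u : L2Graph P => ∫ s in (0 : ℝ)..t, u j s := by
  have hfin : volume.restrict (Ioo 0 (P.T j)) (Ioo 0 t) ≠ ⊤ := measure_ne_top _ _
  have : (fun u : L2Graph P => ∫ s in (0 : ℝ)..t, u j s)
      = fun u : L2Graph P => inner ℝ (indicatorConstLp 2 measurableSet_Ioo hfin (1 : ℝ)) (u j) := by
    funext u
    rw [L2.inner_indicatorConstLp_one, Measure.restrict_restrict measurableSet_Ioo,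
      inter_eq_left.2 (Ioo_subset_Ioo le_rfl ht.2), intervalIntegral.integral_of_le ht.1,
      integral_Ioc_eq_integral_Ioo]
  rw [this]
  fun_prop

/-- The state that vanishes at the origin and has given derivatives. -/
def primitive (P : Params n) (u : L2Graph P) : Fin (n + 1) → ℝ → ℝ :=
  Fin.cons (fun t => ∫ s in (0 : ℝ)..t, u 0 s)
    fun k t => (∫ s in (0 : ℝ)..P.T 0, u 0 s) + ∫ s in (0 : ℝ)..t, u k.succ s

theorem primitive_memW1 {P : Params n} (hP : P.Admissible) (u : L2Graph P) (j : Fin (n + 1)) :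
    MemW1 (primitive P u j) 0 (P.T j) ∧
      deriv (primitive P u j) =ᵐ[volume.restrict (Ioo 0 (P.T j))] u j := by
  refine Fin.cases ?_ (fun k => ?_) j
  · exact memW1_of_integral (K := 0) (hP.T_pos _).le (Lp.memLp (u 0))
      fun t _ => (zero_add _).symm
  · exact memW1_of_integral (hP.T_pos _).le (Lp.memLp (u k.succ)) fun t _ => rfl

theorem primitive_mem_states {P : Params n} (hP : P.Admissible) (u : L2Graph P) :
    primitive P u ∈ states P hP :=
  ⟨fun j => (primitive_memW1 hP u j).1, fun k => by simp [primitive]⟩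

theorem derivMap_primitive {P : Params n} (hP : P.Admissible) (u : L2Graph P) :
    derivMap P hP ⟨primitive P u, primitive_mem_states hP u⟩ = u := by
  refine PiLp.ext fun j => ?_
  have h := primitive_memW1 hP u j
  exact (MemLp.toLp_congr h.1.2 (Lp.memLp (u j)) h.2).trans (Lp.toLp_coeFn _ _)

theorem integral_derivMap {P : Params n} {hP : P.Admissible} (y : states P hP) (j : Fin (n + 1))
    {t : ℝ} (ht : t ∈ Icc 0 (P.T j)) :
    ∫ s in (0 : ℝ)..t, derivMap P hP y j s = y.1 j t - y.1 j 0 := by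
  rw [(y.2.1 j).eq_add_integral ht, add_sub_cancel_left]
  exact integral_congr_ae_Ioo le_rfl ht.1 ht.2 (y.2.1 j).2.coeFn_toLp

theorem isClosed_map_derivMap (P : Params n) (hP : P.Admissible) :
    IsClosed ((variations P hP).map (derivMap P hP) : Set (L2Graph P)) := by
  have h0 : P.T 0 ∈ Icc 0 (P.T 0) := ⟨hP.T_zero_pos.le, le_rfl⟩
  have hsub : ∀ k : Fin n, ∀ t ∈ Icc (P.l k.succ) (P.T k.succ), t ∈ Icc 0 (P.T k.succ) :=
    fun k t ht => ⟨(hP.l_pos _).le.trans ht.1, ht.2⟩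
  have : ((variations P hP).map (derivMap P hP) : Set (L2Graph P))
      = ⋂ k : Fin n, ⋂ t ∈ Icc (P.l k.succ) (P.T k.succ),
        {u : L2Graph P | (∫ s in (0 : ℝ)..P.T 0, u 0 s) + ∫ s in (0 : ℝ)..t, u k.succ s = 0} := by
    ext u
    simp only [mem_iInter, Submodule.map_coe, mem_image, SetLike.mem_coe]
    constructor
    · rintro ⟨v, hv, rfl⟩ k t ht
      change (∫ s in (0 : ℝ)..P.T 0, derivMap P hP v 0 s)
        + ∫ s in (0 : ℝ)..t, derivMap P hP v k.succ s = 0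
      rw [integral_derivMap v 0 h0, integral_derivMap v k.succ (hsub k t ht), v.2.2 k, hv.1,
        hv.2 k t ht]
      ring
    · intro h
      refine ⟨⟨primitive P u, primitive_mem_states hP u⟩, ⟨?_, fun k t ht => h k t ht⟩,
        derivMap_primitive hP u⟩
      simp [primitive]
  rw [this]
  refine isClosed_iInter fun k => isClosed_iInter fun t => isClosed_iInter fun ht => ?_
  exact isClosed_eq ((continuous_integral_apply P 0 h0).add
    (continuous_integral_apply P k.succ (hsub k t ht))) continuous_const

/-- If two linear maps control each other on a subspace and one of the two images of the subspace is
closed, then so is the other. -/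
theorem isClosed_map_of_norm_le {X H₁ H₂ : Type*} [AddCommGroup X] [Module ℝ X]
    [NormedAddCommGroup H₁] [NormedSpace ℝ H₁] [CompleteSpace H₁]
    [NormedAddCommGroup H₂] [NormedSpace ℝ H₂]
    (D : X →ₗ[ℝ] H₁) (L : X →ₗ[ℝ] H₂) (V : Submodule ℝ X) (hD : IsClosed (V.map D : Set H₁))
    {A B : ℝ} (hDL : ∀ v ∈ V, ‖D v‖ ≤ A * ‖L v‖) (hLD : ∀ v ∈ V, ‖L v‖ ≤ B * ‖D v‖) :
    IsClosed (V.map L : Set H₂) := by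
  refine IsSeqClosed.isClosed fun x f hx hf => ?_
  choose v hv hvx using hx
  have hc : CauchySeq fun m => D (v m) := by
    have h1 : ∀ p q, dist (D (v p)) (D (v q)) ≤ |A| * dist (x p) (x q) := fun p q => by
      rw [dist_eq_norm, dist_eq_norm, ← map_sub, ← hvx, ← hvx, ← map_sub]
      refine (hDL _ (V.sub_mem (hv p) (hv q))).trans ?_
      gcongr
      exact le_abs_self A
    refine Metric.cauchySeq_iff.2 fun ε hε => ?_
    obtain ⟨N, hN⟩ := Metric.cauchySeq_iff.1 hf.cauchySeq (ε / (|A| + 1)) (by positivity)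
    refine ⟨N, fun p hp q hq => (h1 p q).trans_lt ?_⟩
    have h2 := hN p hp q hq
    rw [lt_div_iff₀ (by positivity)] at h2
    nlinarith [dist_nonneg (x := x p) (y := x q)]
  obtain ⟨u, hu⟩ := cauchySeq_tendsto_of_complete hc
  obtain ⟨w, hw, rfl⟩ : u ∈ (V.map D : Set H₁) :=
    hD.mem_of_tendsto hu (Filter.Eventually.of_forall fun m => ⟨v m, hv m, rfl⟩)
  have hLw : Filter.Tendsto x Filter.atTop (nhds (L w)) := by
    rw [tendsto_iff_norm_sub_tendsto_zero] at hu ⊢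
    refine squeeze_zero (fun _ => norm_nonneg _) (fun m => ?_) (by simpa using hu.const_mul B)
    rw [← hvx, ← map_sub, ← map_sub]
    exact hLD _ (V.sub_mem (hv m) hw)
  exact ⟨w, hw, tendsto_nhds_unique hLw hf⟩

theorem isClosed_map_ellMap (P : Params n) (hP : P.Admissible) :
    IsClosed ((variations P hP).map (ellMap P hP) : Set (L2Graph P)) := by
  obtain ⟨A, _, h1⟩ := exists_norm_derivMap_le P hP
  obtain ⟨B, _, h2⟩ := exists_norm_ellMap_le P hP
  exact isClosed_map_of_norm_le (derivMap P hP) (ellMap P hP) _ (isClosed_map_derivMap P hP)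
    (fun v hv => h1 v hv.1) (fun v hv => h2 v hv.1)

/-- A state that satisfies the constraints with initial value `1`: it decays linearly to zero on the
incoming edge. -/
def referenceState (P : Params n) : Fin (n + 1) → ℝ → ℝ :=
  Fin.cons (fun t => 1 + ∫ _ in (0 : ℝ)..t, -(P.T 0)⁻¹) fun _ _ => 0

theorem referenceState_mem_states {P : Params n} (hP : P.Admissible) :
    referenceState P ∈ states P hP := by
  refine ⟨fun j => ?_, fun k => ?_⟩
  · refine Fin.cases ?_ (fun k => memW1_const 0 _ _) j
    exact (memW1_of_integral hP.T_zero_pos.le (memLp_const _) fun t _ => rfl).1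
  · simp [referenceState, hP.T_zero_pos.ne']

/-- A state with prescribed initial value whose energy is stationary along the variations. -/
structure IsStationary (P : Params n) (hP : P.Admissible) (y₀ : ℝ) (y : states P hP) : Prop where
  constraints : Constraints P y₀ y.1
  orthogonal : ∀ v ∈ variations P hP, inner ℝ (ellMap P hP y) (ellMap P hP v) = 0

theorem exists_isStationary_one (P : Params n) (hP : P.Admissible) :
    ∃ y : states P hP, IsStationary P hP 1 y := by
  set r : states P hP := ⟨referenceState P, referenceState_mem_states hP⟩
  set R := (variations P hP).map (ellMap P hP)
  obtain ⟨f, hf, hmin⟩ :=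
    R.exists_norm_eq_iInf_of_complete_subspace (isClosed_map_ellMap P hP).isComplete
      (ellMap P hP r)
  have horth := (R.norm_eq_iInf_iff_real_inner_eq_zero hf).1 hmin
  obtain ⟨v, hv, rfl⟩ := hf
  refine ⟨r - v, ⟨?_, fun k => (r - v).2.2 k, fun k t ht => ?_⟩, fun w hw => ?_⟩
  · change referenceState P 0 0 - v.1 0 0 = 1
    rw [hv.1]
    simp [referenceState]
  · change referenceState P k.succ t - v.1 k.succ t = 0
    rw [hv.2 k t ht]
    simp [referenceState]
  · rw [map_sub]
    exact horth _ ⟨w, hw, rfl⟩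

theorem IsStationary.smul {P : Params n} {hP : P.Admissible} {y : states P hP}
    (hy : IsStationary P hP 1 y) (y₀ : ℝ) : IsStationary P hP y₀ (y₀ • y) := by
  refine ⟨⟨?_, fun k => (y₀ • y).2.2 k, fun k t ht => ?_⟩, fun w hw => ?_⟩
  · change y₀ * y.1 0 0 = y₀
    rw [hy.constraints.initial, mul_one]
  · change y₀ * y.1 k.succ t = 0
    rw [hy.constraints.rest k t ht, mul_zero]
  · rw [map_smul, real_inner_smul_left, hy.orthogonal w hw, mul_zero]

theorem sub_mem_variations {P : Params n} {hP : P.Admissible} {y₀ : ℝ} {y z : states P hP}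
    (hy : Constraints P y₀ y.1) (hz : Constraints P y₀ z.1) : z - y ∈ variations P hP := by
  refine ⟨?_, fun k t ht => ?_⟩
  · change z.1 0 0 - y.1 0 0 = 0
    rw [hy.initial, hz.initial, sub_self]
  · change z.1 k.succ t - y.1 k.succ t = 0
    rw [hy.rest k t ht, hz.rest k t ht, sub_self]

theorem eqOnGraph_of_ellMap_sub_eq_zero {P : Params n} {hP : P.Admissible} {y₀ : ℝ}
    {y z : states P hP} (hy : Constraints P y₀ y.1) (hz : Constraints P y₀ z.1)
    (h : ellMap P hP (z - y) = 0) : EqOnGraph P z.1 y.1 := fun j t ht => by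
  have : z.1 j t - y.1 j t = 0 :=
    eqOnGraph_zero_of_ellMap_eq_zero (z - y) (sub_mem_variations hy hz).1 h j ht
  linarith

theorem IsStationary.eqOnGraph {P : Params n} {hP : P.Admissible} {y₀ : ℝ} {y z : states P hP}
    (hy : IsStationary P hP y₀ y) (hz : IsStationary P hP y₀ z) : EqOnGraph P z.1 y.1 := by
  refine eqOnGraph_of_ellMap_sub_eq_zero hy.constraints hz.constraints ?_
  have hm := sub_mem_variations hy.constraints hz.constraints
  rw [← inner_self_eq_zero (𝕜 := ℝ)]
  nth_rewrite 1 [map_sub]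
  rw [inner_sub_left, hy.orthogonal _ hm, hz.orthogonal _ hm, sub_zero]

theorem IsStationary.energy_eq {P : Params n} {hP : P.Admissible} {y₀ : ℝ} {y z : states P hP}
    (hy : IsStationary P hP y₀ y) (hz : Constraints P y₀ z.1) :
    energy P z.1 = energy P y.1 + ‖ellMap P hP (z - y)‖ ^ 2 := by
  have hm := sub_mem_variations hy.constraints hz
  have h := norm_add_sq_real (ellMap P hP y) (ellMap P hP (z - y))
  rw [hy.orthogonal _ hm, ← map_add, add_sub_cancel, norm_ellMap_sq, norm_ellMap_sq] at h
  linarith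

theorem IsStationary.solvesVariational {P : Params n} {hP : P.Admissible} {y₀ : ℝ}
    {y : states P hP} (hy : IsStationary P hP y₀ y) : SolvesVariational P y₀ y.1 := by
  refine ⟨y.2.1, hy.constraints, fun z hz hc => ?_⟩
  have := hy.energy_eq (z := ⟨z, hz, hc.continuity⟩) hc
  have h2 := sq_nonneg ‖ellMap P hP (⟨z, hz, hc.continuity⟩ - y)‖
  change energy P z = _ at this
  linarith

theorem IsStationary.eqOnGraph_of_solvesVariational {P : Params n} {hP : P.Admissible} {y₀ : ℝ}
    {y : states P hP} (hy : IsStationary P hP y₀ y) {z : Fin (n + 1) → ℝ → ℝ}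
    (hz : SolvesVariational P y₀ z) : EqOnGraph P z y.1 := by
  set w : states P hP := ⟨z, hz.memW1, hz.constraints.continuity⟩
  have h1 : energy P w.1 = _ := hy.energy_eq hz.constraints
  have h2 : energy P w.1 ≤ _ := hz.minimal y.1 y.2.1 hy.constraints
  refine eqOnGraph_of_ellMap_sub_eq_zero (z := w) hy.constraints hz.constraints ?_
  rw [← norm_eq_zero, ← sq_eq_zero_iff]
  exact le_antisymm (by linarith) (sq_nonneg _)

/-! ### The weak form of the equations -/

theorem memLp_mono_Ioo {f : ℝ → ℝ} {a b c d : ℝ} (hac : a ≤ c) (hdb : d ≤ b)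
    (hf : MemLp f 2 (volume.restrict (Ioo a b))) : MemLp f 2 (volume.restrict (Ioo c d)) :=
  hf.mono_measure (Measure.restrict_mono_set _ (Ioo_subset_Ioo hac hdb))

section advanced

variable {P : Params n} (hP : P.Admissible)
include hP

theorem memLp_advanced_zero {f : ℝ → ℝ} (hf : MemLp f 2 (volume.restrict (Ioo 0 (P.T 0)))) :
    MemLp (fun t => f (P.q * t)) 2 (volume.restrict (Ioo 0 (P.q⁻¹ * P.T 0))) := by
  have := memLp_comp_affine (φ := f) (a := 0) (b := P.q⁻¹ * P.T 0) (d := 0) hP.q_pos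
    (by simpa [mul_inv_cancel_left₀ hP.q_pos.ne'] using hf)
  simpa only [add_zero] using this

theorem memLp_advanced_incoming (k : Fin n) {f : ℝ → ℝ}
    (hf : MemLp f 2 (volume.restrict (Ioo 0 (P.T k.succ)))) :
    MemLp (fun t => f (P.q * t - P.T 0)) 2 (volume.restrict (Ioo (P.q⁻¹ * P.T 0) (P.T 0))) := by
  refine memLp_comp_affine (d := -P.T 0) hP.q_pos (memLp_mono_Ioo ?_ ?_ hf)
  · rw [mul_inv_cancel_left₀ hP.q_pos.ne', add_neg_cancel]
  · linarith [hP.lt_T_succ k]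

theorem memLp_advanced_outgoing (k : Fin n) {f : ℝ → ℝ}
    (hf : MemLp f 2 (volume.restrict (Ioo 0 (P.T k.succ)))) :
    MemLp (fun t => f (P.q * t + (P.q - 1) * P.T 0)) 2
      (volume.restrict (Ioo (P.q⁻¹ * P.T 0 - P.T 0) (P.l k.succ))) := by
  refine memLp_comp_affine hP.q_pos (memLp_mono_Ioo ?_ ?_ hf)
  · rw [mul_sub, mul_inv_cancel_left₀ hP.q_pos.ne']
    linarith
  · linarith [hP.q_mul_l k]

end advanced

theorem ellTilde_memLp {P : Params n} {hP : P.Admissible} (y : states P hP) (j : Fin (n + 1)) :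
    MemLp (ellTilde P y.1 j) 2 (volume.restrict (Ioo 0 (P.l j))) := by
  have hf := states.ell_memLp y
  refine Fin.cases ?_ (fun k => ?_) j
  · refine memLp_glue ((memLp_advanced_zero hP (hf 0)).const_mul _) (MemLp.const_mul ?_ _)
    exact memLp_finsetSum _ fun k _ => (memLp_advanced_incoming hP k (hf k.succ)).const_mul _
  · have := ((memLp_mono_Ioo (by linarith [hP.q_inv_mul_T_le]) le_rfl
      (memLp_advanced_outgoing hP k (hf k.succ))).const_mul (P.q * P.α k.succ * P.c k.succ) :
      MemLp _ 2 (volume.restrict (Ioo 0 (P.l k.succ))))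
    exact this.ae_eq (ae_Ioo_of_forall fun t ht => (if_pos ht.2).symm)

theorem integral_mul_delayed_zero {P : Params n} (hP : P.Admissible) (f : ℝ → ℝ)
    (v : Fin (n + 1) → ℝ → ℝ) :
    ∫ t in (0 : ℝ)..P.T 0, f t * delayed P v 0 t
      = P.q * ∫ t in (0 : ℝ)..P.q⁻¹ * P.T 0, f (P.q * t) * v 0 t := by
  have hq := hP.q_pos.ne'
  have := intervalIntegral.integral_comp_mul_left (a := 0) (b := P.q⁻¹ * P.T 0)
    (fun t => f t * delayed P v 0 t) hq
  rw [mul_zero, mul_inv_cancel_left₀ hq, smul_eq_mul, eq_inv_mul_iff_mul_eq₀ hq] at this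
  rw [← this]
  congr 2
  funext t
  change _ * v 0 (P.q⁻¹ * (P.q * t)) = _
  rw [inv_mul_cancel_left₀ hq]

/-- The substitution `t = q s + (q - 1) T 0`: the part with `s < 0` runs through the history on the
incoming edge. -/
theorem integral_mul_delayed_succ {P : Params n} {hP : P.Admissible} {f : ℝ → ℝ} (k : Fin n)
    (hf : MemLp f 2 (volume.restrict (Ioo 0 (P.T k.succ)))) (v : states P hP) :
    ∫ t in (0 : ℝ)..P.T k.succ, f t * delayed P v.1 k.succ t
      = P.q * (∫ t in P.q⁻¹ * P.T 0..P.T 0, f (P.q * t - P.T 0) * v.1 0 t)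
        + P.q * ∫ t in (0 : ℝ)..P.l k.succ, f (P.q * t + (P.q - 1) * P.T 0) * v.1 k.succ t := by
  have hq := hP.q_pos.ne'
  have h1 := hP.q_inv_mul_T_le
  have h2 := (hP.l_pos k.succ).le
  have h3 : P.q⁻¹ * P.T 0 - P.T 0 ≤ P.l k.succ := by linarith
  set G : ℝ → ℝ := fun s => f (P.q * s + (P.q - 1) * P.T 0) * withHistory P v.1 k s with hG
  have hGi : IntervalIntegrable G volume (P.q⁻¹ * P.T 0 - P.T 0) (P.l k.succ) :=
    intervalIntegrable_mul h3 (memLp_advanced_outgoing hP k hf)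
      (((withHistory_memW1 hP v.2.1 v.2.2 k).mono le_rfl h3 (hP.l_le_T _)).memLp h3)
  have := intervalIntegral.integral_comp_mul_add (a := P.q⁻¹ * P.T 0 - P.T 0) (b := P.l k.succ)
    (fun t => f t * delayed P v.1 k.succ t) hq ((P.q - 1) * P.T 0)
  have e1 : P.q * (P.q⁻¹ * P.T 0 - P.T 0) + (P.q - 1) * P.T 0 = 0 := by
    rw [mul_sub, mul_inv_cancel_left₀ hq]
    ring
  rw [hP.q_mul_l, e1, sub_add_cancel, smul_eq_mul, eq_inv_mul_iff_mul_eq₀ hq] at this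
  rw [← this, ← mul_add]
  congr 1
  have e2 : (fun s => f (P.q * s + (P.q - 1) * P.T 0)
      * delayed P v.1 k.succ (P.q * s + (P.q - 1) * P.T 0)) = G := by
    funext s
    change _ * withHistory P v.1 k (P.q⁻¹ * (P.q * s + (P.q - 1) * P.T 0 - _)) = _
    rw [add_sub_cancel_right, inv_mul_cancel_left₀ hq]
  rw [e2, ← intervalIntegral.integral_add_adjacent_intervals (b := 0)]
  · congr 1
    · have e3 := intervalIntegral.integral_comp_sub_right (a := P.q⁻¹ * P.T 0) (b := P.T 0)
        G (P.T 0)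
      rw [sub_self] at e3
      rw [← e3]
      refine intervalIntegral.integral_congr_Ioo_of_le h1 fun t ht => ?_
      have ht0 : t - P.T 0 < 0 := by linarith [ht.2]
      have e4 : P.q * (t - P.T 0) + (P.q - 1) * P.T 0 = P.q * t - P.T 0 := by ring
      simp only [hG, withHistory, if_pos ht0, e4, sub_add_cancel]
    · refine intervalIntegral.integral_congr_Ioo_of_le h2 fun t ht => ?_
      simp only [withHistory, if_neg (not_lt.2 ht.1.le)]
  · refine hGi.mono_set ?_
    rw [uIcc_of_le h3, uIcc_of_le (by linarith)]
    exact Icc_subset_Icc le_rfl h2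
  · refine hGi.mono_set ?_
    rw [uIcc_of_le h3, uIcc_of_le h2]
    exact Icc_subset_Icc (by linarith) le_rfl

theorem integral_ellTilde_zero {P : Params n} {hP : P.Admissible} (y v : states P hP) :
    ∫ t in (0 : ℝ)..P.T 0, ellTilde P y.1 0 t * v.1 0 t
      = P.α 0 * P.c 0 * (P.q * ∫ t in (0 : ℝ)..P.q⁻¹ * P.T 0, ell P y.1 0 (P.q * t) * v.1 0 t)
        + ∑ k : Fin n, P.α k.succ * P.c k.succ * (P.q *
          ∫ t in P.q⁻¹ * P.T 0..P.T 0, ell P y.1 k.succ (P.q * t - P.T 0) * v.1 0 t) := by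
  have h0 := hP.q_inv_mul_T_pos.le
  have h1 := hP.q_inv_mul_T_le
  have hv := (v.2.1 0).memLp hP.T_zero_pos.le
  have hi : IntervalIntegrable (fun t => ellTilde P y.1 0 t * v.1 0 t) volume 0 (P.T 0) :=
    intervalIntegrable_mul hP.T_zero_pos.le (ellTilde_memLp y 0) hv
  have hik : ∀ k : Fin n, IntervalIntegrable
      (fun t => ell P y.1 k.succ (P.q * t - P.T 0) * v.1 0 t) volume (P.q⁻¹ * P.T 0) (P.T 0) :=
    fun k => intervalIntegrable_mul h1 (memLp_advanced_incoming hP k (states.ell_memLp y k.succ))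
      (memLp_mono_Ioo h0 le_rfl hv)
  rw [← intervalIntegral.integral_add_adjacent_intervals (b := P.q⁻¹ * P.T 0)]
  · congr 1
    · rw [← mul_assoc, ← intervalIntegral.integral_const_mul]
      refine intervalIntegral.integral_congr_Ioo_of_le h0 fun t ht => ?_
      change (if t < P.q⁻¹ * P.T 0 then _ else _) * _ = _
      rw [if_pos ht.2]
      ring
    · have : ∀ k ∈ (Finset.univ : Finset (Fin n)), IntervalIntegrable
          (fun t => P.α k.succ * P.c k.succ * P.q * (ell P y.1 k.succ (P.q * t - P.T 0) * v.1 0 t)) volume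
          (P.q⁻¹ * P.T 0) (P.T 0) :=
        fun k _ => (hik k).const_mul _
      simp only [← mul_assoc (_ * _) P.q, ← intervalIntegral.integral_const_mul]
      rw [← intervalIntegral.integral_finsetSum this]
      refine intervalIntegral.integral_congr_Ioo_of_le h1 fun t ht => ?_
      change (if t < P.q⁻¹ * P.T 0 then _ else _) * _ = _
      rw [if_neg (not_lt.2 ht.1.le), Finset.mul_sum, Finset.sum_mul]
      exact Finset.sum_congr rfl fun k _ => by ring
  · refine hi.mono_set ?_
    rw [uIcc_of_le h0, uIcc_of_le hP.T_zero_pos.le]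
    exact Icc_subset_Icc le_rfl h1
  · refine hi.mono_set ?_
    rw [uIcc_of_le h1, uIcc_of_le hP.T_zero_pos.le]
    exact Icc_subset_Icc h0 le_rfl

theorem integral_ellTilde_succ {P : Params n} (hP : P.Admissible) (y v : Fin (n + 1) → ℝ → ℝ)
    (k : Fin n) :
    ∫ t in (0 : ℝ)..P.l k.succ, ellTilde P y k.succ t * v k.succ t
      = P.α k.succ * P.c k.succ * (P.q * ∫ t in (0 : ℝ)..P.l k.succ,
          ell P y k.succ (P.q * t + (P.q - 1) * P.T 0) * v k.succ t) := by
  rw [← mul_assoc, ← intervalIntegral.integral_const_mul]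
  refine intervalIntegral.integral_congr_Ioo_of_le (hP.l_pos _).le fun t ht => ?_
  change (if t < P.l k.succ then _ else _) * _ = _
  rw [if_pos ht.2]
  ring

/-- The expressions `ellTilde` result from applying the adjoint of the delay to `ell`. Only
integrals over `[0, l j]` occur, because on an outgoing edge the delayed time of `T j` is `l j`. -/
theorem sum_integral_mul_delayed {P : Params n} {hP : P.Admissible} (y v : states P hP) :
    ∑ j, P.α j * P.c j * ∫ t in (0 : ℝ)..P.T j, ell P y.1 j t * delayed P v.1 j t
      = ∑ j, ∫ t in (0 : ℝ)..P.l j, ellTilde P y.1 j t * v.1 j t := by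
  rw [Fin.sum_univ_succ, Fin.sum_univ_succ, P.l_zero, integral_ellTilde_zero,
    integral_mul_delayed_zero hP]
  simp only [integral_ellTilde_succ hP,
    integral_mul_delayed_succ _ (states.ell_memLp y (Fin.succ _)), mul_add,
    Finset.sum_add_distrib]
  ring

/-- The zeroth order part of the Euler–Lagrange equation on an edge. -/
def source (P : Params n) (y : Fin (n + 1) → ℝ → ℝ) (j : Fin (n + 1)) (t : ℝ) : ℝ :=
  P.α j * P.b j * ell P y j t + ellTilde P y j t

theorem source_memLp {P : Params n} {hP : P.Admissible} (y : states P hP) (j : Fin (n + 1)) :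
    MemLp (source P y.1 j) 2 (volume.restrict (Ioo 0 (P.l j))) :=
  ((memLp_mono_Ioo le_rfl (hP.l_le_T j) (states.ell_memLp y j)).const_mul _).add
    (ellTilde_memLp y j)

theorem integral_eq_integral_l {P : Params n} {hP : P.Admissible} {v : states P hP}
    (hv : v ∈ variations P hP) (j : Fin (n + 1)) {f : ℝ → ℝ}
    (hf : MemLp f 2 (volume.restrict (Ioo 0 (P.T j)))) (b : ℝ) :
    ∫ t in (0 : ℝ)..P.T j, f t * (deriv (v.1 j) t + b * v.1 j t)
      = ∫ t in (0 : ℝ)..P.l j, f t * (deriv (v.1 j) t + b * v.1 j t) := by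
  have h0 := (hP.T_pos j).le
  have h1 := (hP.l_pos j).le
  have hi : IntervalIntegrable (fun t => f t * (deriv (v.1 j) t + b * v.1 j t)) volume 0 (P.T j) :=
    intervalIntegrable_mul h0 hf ((v.2.1 j).2.add (((v.2.1 j).memLp h0).const_mul b))
  rw [← intervalIntegral.integral_add_adjacent_intervals (b := P.l j), add_eq_left]
  · have hz : EqOn (v.1 j) (fun _ => 0) (Ioo (P.l j) (P.T j)) := by
      refine Fin.cases (fun t ht => ?_) (fun k t ht => hv.2 k t (Ioo_subset_Icc_self ht)) j
      exact absurd (ht.1.trans ht.2) (lt_irrefl _)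
    rw [intervalIntegral.integral_congr_Ioo_of_le (hP.l_le_T j) (g := fun _ => 0)]
    · simp
    · intro t ht
      simp [deriv_eqOn_of_eqOn hz ht, hz ht]
  · refine hi.mono_set ?_
    rw [uIcc_of_le h0, uIcc_of_le h1]
    exact Icc_subset_Icc le_rfl (hP.l_le_T j)
  · refine hi.mono_set ?_
    rw [uIcc_of_le h0, uIcc_of_le (hP.l_le_T j)]
    exact Icc_subset_Icc h1 le_rfl

/-- The first variation of the energy. -/
theorem inner_ellMap_eq_weak {P : Params n} {hP : P.Admissible} (y : states P hP) {v : states P hP}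
    (hv : v ∈ variations P hP) :
    inner ℝ (ellMap P hP y) (ellMap P hP v)
      = ∑ j, ((∫ t in (0 : ℝ)..P.l j, P.α j * ell P y.1 j t * deriv (v.1 j) t)
        + ∫ t in (0 : ℝ)..P.l j, source P y.1 j t * v.1 j t) := by
  have e1 : ∀ j, P.α j * ∫ t in (0 : ℝ)..P.T j, ell P y.1 j t * ell P v.1 j t
      = (P.α j * ∫ t in (0 : ℝ)..P.l j, ell P y.1 j t * (deriv (v.1 j) t + P.b j * v.1 j t))
        + P.α j * P.c j * ∫ t in (0 : ℝ)..P.T j, ell P y.1 j t * delayed P v.1 j t := by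
    intro j
    have h0 := (hP.T_pos j).le
    have hf := states.ell_memLp y j
    rw [← integral_eq_integral_l hv j hf, mul_assoc, ← mul_add,
      ← intervalIntegral.integral_const_mul (P.c j), ← intervalIntegral.integral_add]
    · congr 2
      funext t
      rw [ell_eq P v.1]
      ring
    · exact intervalIntegrable_mul h0 hf ((v.2.1 j).2.add (((v.2.1 j).memLp h0).const_mul _))
    · exact (intervalIntegrable_mul h0 hf ((delayed_memW1 hP v.2.1 v.2.2 j).memLp h0)).const_mul _
  rw [inner_ellMap, Finset.sum_congr rfl fun j _ => e1 j, Finset.sum_add_distrib,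
    sum_integral_mul_delayed, ← Finset.sum_add_distrib]
  refine Finset.sum_congr rfl fun j _ => ?_
  have h0 := (hP.l_pos j).le
  have hf := memLp_mono_Ioo le_rfl (hP.l_le_T j) (states.ell_memLp y j)
  have hv' := (v.2.1 j).mono le_rfl h0 (hP.l_le_T j)
  rw [← intervalIntegral.integral_const_mul, ← intervalIntegral.integral_add,
    ← intervalIntegral.integral_add]
  · congr 1
    funext t
    simp only [source]
    ring
  · exact intervalIntegrable_mul h0 (hf.const_mul _) hv'.2
  · exact intervalIntegrable_mul h0 (source_memLp y j) (hv'.memLp h0)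
  · exact (intervalIntegrable_mul h0 hf (hv'.2.add ((hv'.memLp h0).const_mul _))).const_mul _
  · exact intervalIntegrable_mul h0 (ellTilde_memLp y j) (hv'.memLp h0)

/-! ### Equivalence with the boundary value problem -/

/-- A family of fluxes of a state: absolutely continuous representatives of `α_j ℓ_j y` on
`[0, l_j]` that satisfy the Euler–Lagrange equations. -/
structure IsFlux (P : Params n) (y Φ : Fin (n + 1) → ℝ → ℝ) : Prop where
  memW1 : ∀ j, MemW1 (Φ j) 0 (P.l j)
  ae_eq : ∀ j, (fun t => P.α j * ell P y j t) =ᵐ[volume.restrict (Ioo 0 (P.l j))] Φ j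
  deriv_ae_eq : ∀ j, deriv (Φ j) =ᵐ[volume.restrict (Ioo 0 (P.l j))] source P y j

/-- For a state with fluxes, the first variation of the energy only sees the balance of the fluxes
at the internal vertex. -/
theorem IsFlux.inner_ellMap {P : Params n} {hP : P.Admissible} {y : states P hP}
    {Φ : Fin (n + 1) → ℝ → ℝ} (hΦ : IsFlux P y.1 Φ) {v : states P hP}
    (hv : v ∈ variations P hP) :
    inner ℝ (ellMap P hP y) (ellMap P hP v)
      = (Φ 0 (P.T 0) - ∑ k : Fin n, Φ k.succ 0) * v.1 0 (P.T 0) := by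
  have e : ∀ j, (∫ t in (0 : ℝ)..P.l j, P.α j * ell P y.1 j t * deriv (v.1 j) t)
      + ∫ t in (0 : ℝ)..P.l j, source P y.1 j t * v.1 j t
      = Φ j (P.l j) * v.1 j (P.l j) - Φ j 0 * v.1 j 0 := fun j => by
    have h0 := (hP.l_pos j).le
    have hv' := (v.2.1 j).mono le_rfl h0 (hP.l_le_T j)
    have h1 : ∫ t in (0 : ℝ)..P.l j, P.α j * ell P y.1 j t * deriv (v.1 j) t
        = ∫ t in (0 : ℝ)..P.l j, Φ j t * deriv (v.1 j) t := by
      refine integral_congr_ae_Ioo le_rfl h0 le_rfl ?_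
      filter_upwards [hΦ.ae_eq j] with t ht
      rw [ht]
    have h2 : ∫ t in (0 : ℝ)..P.l j, source P y.1 j t * v.1 j t
        = ∫ t in (0 : ℝ)..P.l j, deriv (Φ j) t * v.1 j t := by
      refine integral_congr_ae_Ioo le_rfl h0 le_rfl ?_
      filter_upwards [hΦ.deriv_ae_eq j] with t ht
      rw [ht]
    rw [h1, h2, (hΦ.memW1 j).1.integral_mul_deriv_eq_deriv_mul hv'.1]
    ring
  rw [inner_ellMap_eq_weak y hv, Finset.sum_congr rfl fun j _ => e j, Fin.sum_univ_succ, P.l_zero,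
    hv.1, mul_zero, sub_zero, sub_mul, Finset.sum_mul, sub_eq_add_neg, ← Finset.sum_neg_distrib]
  congr 1
  refine Finset.sum_congr rfl fun k _ => ?_
  rw [hv.2 k _ ⟨le_rfl, hP.l_le_T _⟩, v.2.2 k]
  ring

theorem delayed_zero_apply (P : Params n) (y : Fin (n + 1) → ℝ → ℝ) (t : ℝ) :
    delayed P y 0 t = y 0 (P.q⁻¹ * t) := rfl

theorem delayed_succ_zero {P : Params n} (hP : P.Admissible) (y : Fin (n + 1) → ℝ → ℝ)
    (k : Fin n) : delayed P y k.succ 0 = y 0 (P.q⁻¹ * P.T 0) := by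
  change withHistory P y k (P.q⁻¹ * (0 - (P.q - 1) * P.T 0)) = _
  have h0 := hP.q_pos.ne'
  have e : P.q⁻¹ * (0 - (P.q - 1) * P.T 0) = P.q⁻¹ * P.T 0 - P.T 0 := by
    field_simp
    ring
  have h1 : P.q⁻¹ * P.T 0 < P.T 0 := mul_lt_of_lt_one_left hP.T_zero_pos hP.q_inv_lt_one
  rw [e, withHistory, if_pos (by linarith), sub_add_cancel]

/-- The Kirchhoff-type condition is the balance of the fluxes at the internal vertex. -/
theorem kirchhoff_iff {P : Params n} {hP : P.Admissible} (y : states P hP)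
    {g : Fin (n + 1) → ℝ → ℝ} (hg : ∀ j, ∀ t ∈ Icc 0 (P.l j),
      HasDerivWithinAt (y.1 j) (g j t) (Icc 0 (P.l j)) t) :
    Kirchhoff P y.1 ↔
      P.α 0 * (g 0 (P.T 0) + P.b 0 * y.1 0 (P.T 0) + P.c 0 * delayed P y.1 0 (P.T 0))
        - ∑ k : Fin n, P.α k.succ * (g k.succ 0 + P.b k.succ * y.1 k.succ 0
          + P.c k.succ * delayed P y.1 k.succ 0) = 0 := by
  have h0 : derivWithin (y.1 0) (Icc 0 (P.T 0)) (P.T 0) = g 0 (P.T 0) :=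
    (hg 0 (P.T 0) ⟨hP.T_zero_pos.le, le_rfl⟩).derivWithin
      (uniqueDiffOn_Icc hP.T_zero_pos _ ⟨hP.T_zero_pos.le, le_rfl⟩)
  have hk : ∀ k : Fin n, derivWithin (y.1 k.succ) (Icc 0 (P.l k.succ)) 0 = g k.succ 0 := fun k =>
    (hg k.succ 0 ⟨le_rfl, (hP.l_pos _).le⟩).derivWithin
      (uniqueDiffOn_Icc (hP.l_pos _) _ ⟨le_rfl, (hP.l_pos _).le⟩)
  simp only [Kirchhoff, h0, hk, Params.β, Params.γ, delayed_succ_zero hP, y.2.2,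
    delayed_zero_apply]
  simp only [mul_add, Finset.sum_add_distrib, sub_mul, Finset.sum_mul, ← mul_assoc]
  constructor <;> intro h <;> linarith

theorem ell_eq_of_hasDerivWithinAt {P : Params n} {y : Fin (n + 1) → ℝ → ℝ} {j : Fin (n + 1)}
    {g : ℝ → ℝ} (hg : ∀ t ∈ Icc 0 (P.l j), HasDerivWithinAt (y j) (g t) (Icc 0 (P.l j)) t) :
    EqOn (ell P y j) (fun t => g t + P.b j * y j t + P.c j * delayed P y j t)
      (Ioo 0 (P.l j)) := fun t ht => by
  have h1 := ((hg t (Ioo_subset_Icc_self ht)).hasDerivAt (Icc_mem_nhds ht.1 ht.2)).deriv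
  rw [ell_eq, h1]

theorem SolvesBVP.isStationary {P : Params n} {hP : P.Admissible} {y₀ : ℝ}
    {z : Fin (n + 1) → ℝ → ℝ} (hz : SolvesBVP P y₀ z) :
    IsStationary P hP y₀ ⟨z, hz.memW1, hz.constraints.continuity⟩ := by
  set y : states P hP := ⟨z, hz.memW1, hz.constraints.continuity⟩ with hy
  refine ⟨hz.constraints, fun v hv => ?_⟩
  choose g hgW hg using hz.memW2
  set Φ : Fin (n + 1) → ℝ → ℝ := fun j =>
    P.α j • (g j + P.b j • z j + P.c j • delayed P z j) with hΦ
  have hell : ∀ j, EqOn (fun t => P.α j * ell P z j t) (Φ j) (Ioo 0 (P.l j)) := fun j t ht => by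
    simp only [ell_eq_of_hasDerivWithinAt (hg j) ht]
    rfl
  have hflux : IsFlux P y.1 Φ := by
    refine ⟨fun j => ?_, fun j => ae_Ioo_of_forall (hell j), fun j => ?_⟩
    · have h0 := (hP.l_pos j).le
      exact (((hgW j).add h0 (((hz.memW1 j).mono le_rfl h0 (hP.l_le_T j)).const_smul _)).add h0
        (((delayed_memW1 hP hz.memW1 hz.constraints.continuity j).mono le_rfl h0
          (hP.l_le_T j)).const_smul _)).const_smul _
    · filter_upwards [hz.equation j, ae_Ioo_of_forall (deriv_eqOn_of_eqOn (hell j))] with t h1 h2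
      rw [← h2]
      change deriv (P.α j • ell P z j) t = _
      rw [deriv_const_smul_fun]
      simp only [calL] at h1
      simp only [source, Pi.smul_apply, smul_eq_mul, hy]
      linarith
  rw [hflux.inner_ellMap hv]
  have : Φ 0 (P.T 0) - ∑ k : Fin n, Φ k.succ 0 = 0 := (kirchhoff_iff y hg).1 hz.kirchhoff
  rw [this, zero_mul]

/-- A du Bois-Reymond lemma: an integrated form of `f' = h`, tested with the functions of `W_2^1`
that vanish at both end points, implies that `f` has a representative in `W_2^1` with derivative
`h`. -/
theorem exists_memW1_of_forall_integral {f h : ℝ → ℝ} {l : ℝ} (hl : 0 < l)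
    (hf : MemLp f 2 (volume.restrict (Ioo 0 l))) (hh : MemLp h 2 (volume.restrict (Ioo 0 l)))
    (H : ∀ φ : ℝ → ℝ, MemLp φ 2 (volume.restrict (Ioo 0 l)) → ∫ t in (0 : ℝ)..l, φ t = 0 →
      (∫ t in (0 : ℝ)..l, f t * φ t) + ∫ t in (0 : ℝ)..l, h t * ∫ s in (0 : ℝ)..t, φ s = 0) :
    ∃ Φ, MemW1 Φ 0 l ∧ f =ᵐ[volume.restrict (Ioo 0 l)] Φ ∧
      deriv Φ =ᵐ[volume.restrict (Ioo 0 l)] h := by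
  set G : ℝ → ℝ := fun t => ∫ s in (0 : ℝ)..t, h s with hG
  have hGW : MemW1 G 0 l ∧ deriv G =ᵐ[volume.restrict (Ioo 0 l)] h :=
    memW1_of_integral (K := 0) hl.le hh fun t _ => (zero_add _).symm
  set m : ℝ := l⁻¹ * ∫ t in (0 : ℝ)..l, (f t - G t) with hm
  have hF : MemLp (fun t => f t - G t) 2 (volume.restrict (Ioo 0 l)) :=
    hf.sub (hGW.1.memLp hl.le)
  -- The test function has the derivative `f - G - m`, where `m` is the mean value of `f - G`.
  set φ : ℝ → ℝ := fun t => f t - G t - m with hφ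
  have hφL : MemLp φ 2 (volume.restrict (Ioo 0 l)) := hF.sub (memLp_const m)
  have hφi := intervalIntegrable_of_memLp hl.le hφL
  have hφ0 : ∫ t in (0 : ℝ)..l, φ t = 0 := by
    rw [intervalIntegral.integral_sub (intervalIntegrable_of_memLp hl.le hF)
      intervalIntegrable_const, intervalIntegral.integral_const, sub_zero, smul_eq_mul, hm,
      mul_inv_cancel_left₀ hl.ne', sub_self]
  set w : ℝ → ℝ := fun t => ∫ s in (0 : ℝ)..t, φ s with hw
  have hwW : MemW1 w 0 l ∧ deriv w =ᵐ[volume.restrict (Ioo 0 l)] φ :=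
    memW1_of_integral (K := 0) hl.le hφL fun t _ => (zero_add _).symm
  have h1 : ∫ t in (0 : ℝ)..l, h t * w t = -∫ t in (0 : ℝ)..l, G t * φ t := by
    have e1 : ∫ t in (0 : ℝ)..l, h t * w t = ∫ t in (0 : ℝ)..l, deriv G t * w t := by
      refine integral_congr_ae_Ioo le_rfl hl.le le_rfl ?_
      filter_upwards [hGW.2] with t ht
      rw [ht]
    have e2 : ∫ t in (0 : ℝ)..l, G t * φ t = ∫ t in (0 : ℝ)..l, G t * deriv w t := by
      refine integral_congr_ae_Ioo le_rfl hl.le le_rfl ?_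
      filter_upwards [hwW.2] with t ht
      rw [ht]
    have hw0 : w 0 = 0 := intervalIntegral.integral_same
    have hwl : w l = 0 := hφ0
    rw [e1, e2, hGW.1.1.integral_mul_deriv_eq_deriv_mul hwW.1.1, hw0, hwl]
    ring
  have h2 := H φ hφL hφ0
  rw [h1, ← sub_eq_add_neg, ← intervalIntegral.integral_sub
    (intervalIntegrable_mul hl.le hf hφL)
    (intervalIntegrable_mul hl.le (hGW.1.memLp hl.le) hφL)] at h2
  have h3 : ∫ t in (0 : ℝ)..l, φ t * φ t = 0 := by
    have e : (fun t => φ t * φ t) = fun t => (f t * φ t - G t * φ t) - m * φ t := by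
      funext t
      simp only [hφ]
      ring
    rw [e, intervalIntegral.integral_sub, h2, intervalIntegral.integral_const_mul, hφ0]
    · simp
    · exact (intervalIntegrable_mul hl.le hf hφL).sub
        (intervalIntegrable_mul hl.le (hGW.1.memLp hl.le) hφL)
    · exact hφi.const_mul m
  have h4 : φ =ᵐ[volume.restrict (Ioo 0 l)] 0 := by
    rw [intervalIntegral.integral_of_le hl.le, integral_Ioc_eq_integral_Ioo,
      integral_eq_zero_iff_of_nonneg (fun t => mul_self_nonneg _) (hφL.integrable_mul hφL)] at h3
    filter_upwards [h3] with t ht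
    exact mul_self_eq_zero.1 ht
  have hΦ := memW1_of_integral (f := fun t => m + G t) (K := m) hl.le hh fun t _ => rfl
  refine ⟨_, hΦ.1, ?_, hΦ.2⟩
  filter_upwards [h4] with t ht
  have : f t - G t - m = 0 := ht
  linarith

theorem hasDerivWithinAt_of_integral {f g : ℝ → ℝ} {l K : ℝ} (hl : 0 ≤ l)
    (hg : ContinuousOn g (Icc 0 l)) (h : ∀ t ∈ Icc 0 l, f t = K + ∫ s in (0 : ℝ)..t, g s) :
    ∀ t ∈ Icc 0 l, HasDerivWithinAt f (g t) (Icc 0 l) t := by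
  intro t ht
  set G : ℝ → ℝ := IccExtend hl ((Icc 0 l).domRestrict g) with hG
  have hGc : Continuous G := hg.domRestrict.Icc_extend'
  have hGe : ∀ s ∈ Icc 0 l, G s = g s := fun s hs => IccExtend_of_mem hl _ hs
  have hd : HasDerivAt (fun t => K + ∫ s in (0 : ℝ)..t, G s) (G t) t :=
    (hGc.integral_hasStrictDerivAt 0 t).hasDerivAt.const_add K
  rw [← hGe t ht]
  have heq : ∀ s ∈ Icc 0 l, f s = K + ∫ s in (0 : ℝ)..s, G s := fun s hs => by
    rw [h s hs]
    congr 1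
    refine intervalIntegral.integral_congr_Ioo_of_le hs.1 fun r hr => ?_
    exact (hGe r ⟨hr.1.le, hr.2.le.trans hs.2⟩).symm
  exact hd.hasDerivWithinAt.congr heq (heq t ht)

/-- A square integrable function with mean value zero on `(0, l j)` is the derivative of a variation
that is supported on the `j`-th edge. -/
theorem exists_variation_single (P : Params n) (hP : P.Admissible) (j : Fin (n + 1)) {φ : ℝ → ℝ}
    (hφ : MemLp φ 2 (volume.restrict (Ioo 0 (P.l j)))) (h0 : ∫ t in (0 : ℝ)..P.l j, φ t = 0) :
    ∃ v ∈ variations P hP, (∀ i, i ≠ j → v.1 i = 0) ∧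
      (∀ t ∈ Icc 0 (P.l j), v.1 j t = ∫ s in (0 : ℝ)..t, φ s) ∧
      deriv (v.1 j) =ᵐ[volume.restrict (Ioo 0 (P.l j))] φ := by
  have hl := (hP.l_pos j).le
  have hw1 := memW1_of_integral (f := fun t => ∫ s in (0 : ℝ)..t, φ s) (K := 0) hl hφ
    fun t _ => (zero_add _).symm
  set w : ℝ → ℝ := fun t => if t < P.l j then ∫ s in (0 : ℝ)..t, φ s else 0 with hw
  have hwW : MemW1 w 0 (P.T j) :=
    hw1.1.glue hl (hP.l_le_T j) (memW1_const 0 _ _) h0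
  have hw0 : w 0 = 0 := by simp [hw]
  have hwl : ∀ t, P.l j ≤ t → w t = 0 := fun t ht => if_neg (not_lt.2 ht)
  have hwi : ∀ t ∈ Icc 0 (P.l j), w t = ∫ s in (0 : ℝ)..t, φ s := fun t ht => by
    rcases ht.2.lt_or_eq with h | h
    · exact if_pos h
    · rw [hwl t h.ge, h, h0]
  set u : Fin (n + 1) → ℝ → ℝ := Function.update 0 j w with hu
  have huj : u j = w := Function.update_self _ _ _
  have hui : ∀ i, i ≠ j → u i = 0 := fun i hi => Function.update_of_ne hi _ _
  have hu0 : ∀ i, u i 0 = 0 := fun i => by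
    rcases eq_or_ne i j with rfl | hi
    · rw [huj, hw0]
    · rw [hui i hi]; rfl
  have hul : ∀ i, ∀ t, P.l i ≤ t → u i t = 0 := fun i t ht => by
    rcases eq_or_ne i j with rfl | hi
    · rw [huj, hwl t ht]
    · rw [hui i hi]; rfl
  have hmem : u ∈ states P hP := by
    refine ⟨fun i => ?_, fun k => ?_⟩
    · rcases eq_or_ne i j with rfl | hi
      · rwa [huj]
      · rw [hui i hi]; exact memW1_const 0 _ _
    · exact (hu0 _).trans (hul 0 (P.T 0) le_rfl).symm
  refine ⟨⟨u, hmem⟩, ⟨hu0 0, fun k t ht => hul _ t ht.1⟩, hui, fun t ht => ?_, ?_⟩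
  · change u j t = _
    rw [huj, hwi t ht]
  · change deriv (u j) =ᵐ[_] _
    rw [huj]
    refine Filter.EventuallyEq.trans (ae_Ioo_of_forall (deriv_eqOn_of_eqOn fun t ht => ?_)) hw1.2
    exact hwi t (Ioo_subset_Icc_self ht)

theorem memW1_affine (a b p d : ℝ) (hab : a ≤ b) : MemW1 (fun t => p * t + d) a b :=
  (memW1_of_integral (φ := fun _ => p) (K := p * a + d) hab (memLp_const p) fun t _ => by
    rw [intervalIntegral.integral_const, smul_eq_mul]; ring).1

/-- There is a variation that does not vanish at the internal vertex. -/
theorem exists_variation_vertex (P : Params n) (hP : P.Admissible) :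
    ∃ v ∈ variations P hP, v.1 0 (P.T 0) = 1 := by
  set u : Fin (n + 1) → ℝ → ℝ := Fin.cons (fun t => (P.T 0)⁻¹ * t + 0)
    fun (k : Fin n) t => if t < P.l k.succ then -(P.l k.succ)⁻¹ * t + 1 else 0 with hu
  have h1 : u 0 (P.T 0) = 1 := by simp [hu, hP.T_zero_pos.ne']
  have hmem : u ∈ states P hP := by
    refine ⟨fun j => ?_, fun k => ?_⟩
    · refine Fin.cases ?_ (fun k => ?_) j
      · exact memW1_affine _ _ _ _ hP.T_zero_pos.le
      · exact (memW1_affine _ _ _ _ (hP.l_pos _).le).glue (hP.l_pos _).le (hP.l_le_T _)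
          (memW1_const 0 _ _) (by simp [(hP.l_pos k.succ).ne'])
    · rw [h1]
      simp [hu, hP.l_pos k.succ]
  refine ⟨⟨u, hmem⟩, ⟨?_, fun k t ht => ?_⟩, h1⟩
  · simp [hu]
  · simp [hu, not_lt.2 ht.1]

theorem IsStationary.exists_isFlux {P : Params n} {hP : P.Admissible} {y₀ : ℝ} {y : states P hP}
    (hy : IsStationary P hP y₀ y) : ∃ Φ, IsFlux P y.1 Φ := by
  have h : ∀ j, ∃ Φ, MemW1 Φ 0 (P.l j) ∧
      (fun t => P.α j * ell P y.1 j t) =ᵐ[volume.restrict (Ioo 0 (P.l j))] Φ ∧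
      deriv Φ =ᵐ[volume.restrict (Ioo 0 (P.l j))] source P y.1 j := by
    intro j
    refine exists_memW1_of_forall_integral (hP.l_pos j)
      ((memLp_mono_Ioo le_rfl (hP.l_le_T j) (states.ell_memLp y j)).const_mul _)
      (source_memLp y j) fun φ hφ h0 => ?_
    obtain ⟨v, hv, hvi, hvj, hvd⟩ := exists_variation_single P hP j hφ h0
    have h1 := hy.orthogonal v hv
    rw [inner_ellMap_eq_weak y hv, Finset.sum_eq_single j] at h1
    · refine Eq.trans (congrArg₂ (· + ·) ?_ ?_) h1
      · refine integral_congr_ae_Ioo le_rfl (hP.l_pos j).le le_rfl ?_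
        filter_upwards [hvd] with t ht
        rw [ht]
      · refine intervalIntegral.integral_congr_Ioo_of_le (hP.l_pos j).le fun t ht => ?_
        simp only [hvj t (Ioo_subset_Icc_self ht)]
    · intro i _ hi
      have : deriv (0 : ℝ → ℝ) = 0 := by
        funext t
        exact deriv_const t 0
      simp [hvi i hi, this]
    · simp
  choose Φ h1 h2 h3 using h
  exact ⟨Φ, h1, h2, h3⟩

theorem IsStationary.solvesBVP {P : Params n} {hP : P.Admissible} {y₀ : ℝ} {y : states P hP}
    (hy : IsStationary P hP y₀ y) : SolvesBVP P y₀ y.1 := by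
  obtain ⟨Φ, hΦ⟩ := hy.exists_isFlux
  have hα : ∀ j, P.α j ≠ 0 := fun j => (hP.α_pos j).ne'
  set g : Fin (n + 1) → ℝ → ℝ := fun j =>
    (P.α j)⁻¹ • Φ j + (-P.b j) • y.1 j + (-P.c j) • delayed P y.1 j with hg
  have hgW : ∀ j, MemW1 (g j) 0 (P.l j) := fun j => by
    have h0 := (hP.l_pos j).le
    exact (((hΦ.memW1 j).const_smul _).add h0
      (((y.2.1 j).mono le_rfl h0 (hP.l_le_T j)).const_smul _)).add h0
      (((delayed_memW1 hP y.2.1 y.2.2 j).mono le_rfl h0 (hP.l_le_T j)).const_smul _)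
  have hflux : ∀ j t, P.α j * (g j t + P.b j * y.1 j t + P.c j * delayed P y.1 j t) = Φ j t := by
    intro j t
    simp only [hg, Pi.add_apply, Pi.smul_apply, smul_eq_mul]
    have := hα j
    field_simp
    ring
  have hder : ∀ j, deriv (y.1 j) =ᵐ[volume.restrict (Ioo 0 (P.l j))] g j := fun j => by
    filter_upwards [hΦ.ae_eq j] with t ht
    rw [← hflux j t, ell_eq] at ht
    have := mul_left_cancel₀ (hα j) ht
    linarith
  have hgd : ∀ j, ∀ t ∈ Icc 0 (P.l j),
      HasDerivWithinAt (y.1 j) (g j t) (Icc 0 (P.l j)) t := fun j =>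
    hasDerivWithinAt_of_integral (hP.l_pos j).le ((hgW j).continuousOn (hP.l_pos j).le)
      fun t ht => by
        rw [(y.2.1 j).eq_add_integral ⟨ht.1, ht.2.trans (hP.l_le_T j)⟩,
          integral_congr_ae_Ioo le_rfl ht.1 ht.2 (hder j)]
  refine ⟨y.2.1, fun j => ⟨g j, hgW j, hgd j⟩, hy.constraints, fun j => ?_, ?_⟩
  · have hell : EqOn (P.α j • ell P y.1 j) (Φ j) (Ioo 0 (P.l j)) := fun t ht => by
      rw [← hflux, Pi.smul_apply, ell_eq_of_hasDerivWithinAt (hgd j) ht, smul_eq_mul]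
    filter_upwards [hΦ.deriv_ae_eq j, ae_Ioo_of_forall (deriv_eqOn_of_eqOn hell)] with t h1 h2
    rw [h1, deriv_const_smul_fun] at h2
    simp only [source, Pi.smul_apply, smul_eq_mul] at h2
    simp only [calL]
    linarith
  · obtain ⟨v, hv, hv1⟩ := exists_variation_vertex P hP
    have h1 := hΦ.inner_ellMap hv
    rw [hy.orthogonal v hv, hv1, mul_one] at h1
    rw [kirchhoff_iff y hgd]
    simp only [hflux]
    exact h1.symm

theorem normW1Graph_smul (P : Params n) (a : ℝ) (y : Fin (n + 1) → ℝ → ℝ) :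
    normW1Graph P (a • y) = normW1Graph P y * |a| := by
  have : ∀ j, normSqW1 ((a • y) j) 0 (P.T j) = a ^ 2 * normSqW1 (y j) 0 (P.T j) := fun j => by
    simp only [normSqW1, Pi.smul_apply, deriv_const_smul_fun, smul_eq_mul, mul_pow,
      intervalIntegral.integral_const_mul, mul_add]
  simp only [normW1Graph, this]
  rw [← Finset.mul_sum, Real.sqrt_mul (sq_nonneg a), Real.sqrt_sq_eq_abs, mul_comm]

end StarGraph

end


theorem theorem3 (n : ℕ) (hn : 1 ≤ n) (P : StarGraph.Params n)
    (hq : 1 < P.q) (hT₀ : 0 < P.T 0)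
    (hT : ∀ k : Fin n, (P.q - 1) * P.T 0 < P.T k.succ)
    (hα : ∀ j, 0 < P.α j) :
    ∃ C : ℝ, ∀ y₀ : ℝ, ∃ y : Fin (n + 1) → ℝ → ℝ,
      (StarGraph.SolvesBVP P y₀ y ∧
        ∀ z, StarGraph.SolvesBVP P y₀ z → StarGraph.EqOnGraph P z y) ∧
      StarGraph.normW1Graph P y ≤ C * |y₀| ∧
      (StarGraph.SolvesVariational P y₀ y ∧
        ∀ z, StarGraph.SolvesVariational P y₀ z → StarGraph.EqOnGraph P z y) := by
  have hP : P.Admissible := ⟨hq, hT₀, hT, hα⟩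
  obtain ⟨y, hy⟩ := StarGraph.exists_isStationary_one P hP
  refine ⟨StarGraph.normW1Graph P y.1, fun y₀ => ⟨(y₀ • y).1, ⟨(hy.smul y₀).solvesBVP,
    fun z hz => (hy.smul y₀).eqOnGraph hz.isStationary⟩, ?_, (hy.smul y₀).solvesVariational,
    fun z hz => (hy.smul y₀).eqOnGraph_of_solvesVariational hz⟩⟩
  exact (StarGraph.normW1Graph_smul P y₀ y.1).le
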